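/- Let $k$ be a field and let $Q=(Q_0,Q_1,s,t)$ be a finite quiver whose underlying graph is a Dynkin diagram $A_n$ ($n\ge 1$), $D_n$ ($n\ge 4$), $E_6$, $E_7$ or $E_8$. Representations $X=(X_i,X_\alpha)$ of $Q$ over $k$ are finite dimensional; for a vertex $i$ let $P(i)$ be the representation with $P(i)_j=k[Q(i,j)]$, the vector space with basis the set $Q(i,j)$ of paths from $i$ to $j$, on which an arrow acts by composition of paths. Fix an admissible ordering $i_1,\dots,i_n$ of the vertices (each $i_p$ is a sink of $\sigma_{i_{p-1}}\cdots\sigma_{i_1}Q$, where $\sigma_i$ reverses all arrows at $i$), and let $C^+=S^+_{i_n}\cdots S^+_{i_1}$ and $C^-=S^-_{i_1}\cdots S^-_{i_n}$ be the Coxeter functors, composed of the Bernstein–Gelfand–Ponomarev reflection functors. For $r\in\mathbb Z$ put $C^r=(C^+)^r$ if $r\ge 0$ and $C^r=(C^-)^{-r}$ if $r<0$. A morphism $\phi$ is irreducible if it is neither a split monomorphism nor a split epimorphism and if, for every factorisation $\phi=\phi''\phi'$, $\phi'$ is a split monomorphism or $\phi''$ is a split epimorphism. The radical $\operatorname{Rad}(X,Y)$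 is the set of all $\phi\in\operatorname{Hom}(X,Y)$ such that $\tau\phi\sigma$ is not invertible for all indecomposable $Z$ and all $\sigma\colon Z\to X$, $\tau\colon Y\to Z$. Let $\operatorname{Rad}^0(X,Y)=\operatorname{Hom}(X,Y)$, and for $n>0$ let $\operatorname{Rad}^n(X,Y)$ be the set of all composites $\phi''\phi'$ with $\phi'\in\operatorname{Rad}(X,Z)$ and $\phi''\in\operatorname{Rad}^{n-1}(Z,Y)$ for some representation $Z$. Let $X\cong C^rP(i)$ and $Y\cong C^sP(j)$ be two indecomposable representations of $Q$, where $i,j\in Q_0$ and $r,s\in\mathbb Z$. Then: 1. $\operatorname{End}(X)\cong k$ as $k$-algebras, and every morphism $X\to Y$ that is not an isomorphism is a finite (possibly empty) sum of compositions of irreducible morphisms between indecomposable representations. 2. There exists an irreducible morphism $X\to Y$ if and only if either $r=s$ and there exists an arrow $j\to i$ in $Q$, or $r=s+1$ and there exists an arrow $i\to j$ in $Q$. For any two irreducible morphisms $\phi,\phi'\colon X\to Y$ there exists $\lambda\in k$ with $\phi'=\lambda\phi$. 3. There exists an integer $d=d(X,Y)\ge 0$ such that $$\operatorname{Hom}(X,Y)=\operatorname{Rad}^0(X,Y)=\dots=\operatorname{Rad}^d(X,Y)\supseteq\operatorname{Rad}^{d+1}(X,Y)=0.$$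 -/

import Mathlib

open CategoryTheory

namespace QuivRep

/-! ### Quivers -/

/-- A quiver with vertices `V` and arrows `A`; an arrow `α` starts at `s α` and ends at `t α`. -/
@[ext]
structure FinQuiver (V A : Type) where
  s : A → V
  t : A → V

namespace FinQuiver

variable {V A : Type}

/-- Paths of `Q` starting at `i`: `nil` is the trivial path and `cons α p` is `p` followed by the
arrow `α`. -/
inductive Path (Q : FinQuiver V A) (i : V) : V → Type
  | nil : Path Q i i
  | cons (α : A) (p : Path Q i (Q.s α)) : Path Q i (Q.t α)

def IsSink (Q : FinQuiver V A) (i : V) : Prop := ∀ α, Q.s α ≠ i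

def IsSource (Q : FinQuiver V A) (i : V) : Prop := ∀ α, Q.t α ≠ i

variable [DecidableEq V]

/-- `σ_i Q`: reverse all arrows which start or end at `i`. -/
def reflect (Q : FinQuiver V A) (i : V) : FinQuiver V A where
  s α := if Q.s α = i ∨ Q.t α = i then Q.t α else Q.s α
  t α := if Q.s α = i ∨ Q.t α = i then Q.s α else Q.t α

/-- `σ_{i_n} ⋯ σ_{i_1} Q` for the list `[i_1, …, i_n]`. -/
def reflectList (Q : FinQuiver V A) : List V → FinQuiver V A
  | [] => Q
  | i :: L => (Q.reflect i).reflectList L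

/-- Each `i_p` is a sink of `σ_{i_{p-1}} ⋯ σ_{i_1} Q`. -/
def SinkSequence (Q : FinQuiver V A) : List V → Prop
  | [] => True
  | i :: L => Q.IsSink i ∧ (Q.reflect i).SinkSequence L

/-- An admissible ordering of the vertices: a list in which each vertex occurs exactly once and
whose `p`-th entry `i_p` is a sink of `σ_{i_{p-1}} ⋯ σ_{i_1} Q`. -/
structure IsAdmissible (Q : FinQuiver V A) (L : List V) : Prop where
  nodup : L.Nodup
  mem : ∀ i, i ∈ L
  sinks : Q.SinkSequence L

theorem reflect_reflect (Q : FinQuiver V A) (i : V) : (Q.reflect i).reflect i = Q := by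
  ext α <;> simp only [reflect] <;> split_ifs <;> grind

theorem IsSink.isSource_reflect {Q : FinQuiver V A} {i : V} (h : Q.IsSink i) :
    (Q.reflect i).IsSource i := by
  intro α
  have := h α
  simp only [reflect]
  split_ifs <;> grind

theorem reflectList_apply (L : List V) (hL : L.Nodup) (Q : FinQuiver V A) (α : A) :
    (Q.reflectList L).s α = (if (Q.s α ∈ L ↔ Q.t α ∈ L) then Q.s α else Q.t α) ∧
    (Q.reflectList L).t α = (if (Q.s α ∈ L ↔ Q.t α ∈ L) then Q.t α else Q.s α) := by
  induction L generalizing Q with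
  | nil => simp [reflectList]
  | cons i L ih =>
    rw [List.nodup_cons] at hL
    have h := ih hL.2 (Q.reflect i)
    rw [reflectList, h.1, h.2]
    simp only [reflect, List.mem_cons]
    grind

theorem IsAdmissible.reflectList_eq {Q : FinQuiver V A} {L : List V} (h : Q.IsAdmissible L) :
    Q.reflectList L = Q := by
  ext α
  · simp [(reflectList_apply L h.nodup Q α).1, h.mem]
  · simp [(reflectList_apply L h.nodup Q α).2, h.mem]

end FinQuiver

/-! ### Dynkin diagrams -/

/-- The graph on `0, …, n - 1` consisting of the path `0 — 1 — ⋯ — (n - 2)` and a further vertex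
`n - 1` joined to the vertex `b` only. -/
def forkGraph (n b : ℕ) : SimpleGraph (Fin n) :=
  SimpleGraph.fromRel fun i j =>
    (i.val + 1 = j.val ∧ j.val + 1 < n) ∨ (i.val = b ∧ j.val + 1 = n)

/-- The list of Dynkin diagrams `A_n` (`n ≥ 1`), `D_n` (`n ≥ 4`), `E_6`, `E_7`, `E_8`. -/
inductive IsDynkinDiagram : (n : ℕ) → SimpleGraph (Fin n) → Prop
  | A (n : ℕ) (hn : 1 ≤ n) : IsDynkinDiagram n (SimpleGraph.pathGraph n)
  | D (n : ℕ) (hn : 4 ≤ n) : IsDynkinDiagram n (forkGraph n (n - 3))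
  | E6 : IsDynkinDiagram 6 (forkGraph 6 2)
  | E7 : IsDynkinDiagram 7 (forkGraph 7 2)
  | E8 : IsDynkinDiagram 8 (forkGraph 8 2)

/-- The underlying graph of `Q` is, up to a renaming of the vertices, a Dynkin diagram: every arrow
joins two adjacent vertices of the diagram, and any two adjacent vertices are joined by exactly one
arrow. -/
def FinQuiver.IsDynkin {V A : Type} (Q : FinQuiver V A) : Prop :=
  ∃ (n : ℕ) (Γ : SimpleGraph (Fin n)) (e : V ≃ Fin n), IsDynkinDiagram n Γ ∧
    (∀ α, Γ.Adj (e (Q.s α)) (e (Q.t α))) ∧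
    ∀ i j, Γ.Adj (e i) (e j) →
      ∃! α, (Q.s α = i ∧ Q.t α = j) ∨ (Q.s α = j ∧ Q.t α = i)

/-! ### Representations -/

universe u

/-- A representation of `Q` over `k`, not necessarily finite dimensional. -/
structure QRep {V A : Type} (Q : FinQuiver V A) (k : Type u) [Field k] where
  sp : V → ModuleCat.{u} k
  map : ∀ α : A, sp (Q.s α) →ₗ[k] sp (Q.t α)

noncomputable section

namespace QRep

variable {V A : Type} {Q Q' : FinQuiver V A} {k : Type u} [Field k]

/-- The vector space of morphisms `X → Y`. -/
def homSubmodule (X Y : QRep Q k) : Submodule k (∀ i, X.sp i →ₗ[k] Y.sp i) where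
  carrier := {φ | ∀ α, Y.map α ∘ₗ φ (Q.s α) = φ (Q.t α) ∘ₗ X.map α}
  add_mem' {φ ψ} hφ hψ α := by
    simp only [Pi.add_apply, LinearMap.comp_add, LinearMap.add_comp, hφ α, hψ α]
  zero_mem' α := by simp
  smul_mem' c φ hφ α := by
    simp only [Pi.smul_apply, LinearMap.comp_smul, LinearMap.smul_comp, hφ α]

instance : Category (QRep Q k) where
  Hom X Y := homSubmodule X Y
  id X := ⟨fun _ => LinearMap.id, fun _ => rfl⟩
  comp {X Y Z} φ ψ := ⟨fun i => ψ.1 i ∘ₗ φ.1 i, fun α => by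
    rw [← LinearMap.comp_assoc, ψ.2 α, LinearMap.comp_assoc, φ.2 α, LinearMap.comp_assoc]⟩

instance : Preadditive (QRep Q k) where
  homGroup X Y := inferInstanceAs (AddCommGroup (homSubmodule X Y))
  add_comp _ _ _ _ _ _ := Subtype.ext (funext fun _ => LinearMap.comp_add _ _ _)
  comp_add _ _ _ _ _ _ := Subtype.ext (funext fun _ => LinearMap.add_comp _ _ _)

instance : Linear k (QRep Q k) where
  homModule X Y := inferInstanceAs (Module k (homSubmodule X Y))
  smul_comp _ _ _ _ _ _ := Subtype.ext (funext fun _ => LinearMap.comp_smul _ _ _)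
  comp_smul _ _ _ _ _ _ := Subtype.ext (funext fun _ => LinearMap.smul_comp _ _ _)

def FinDim (X : QRep Q k) : Prop := ∀ i, Module.Finite k (X.sp i)

/-- Every vector space of `X` is zero. -/
def IsZeroRep (X : QRep Q k) : Prop := ∀ i, Subsingleton (X.sp i)

/-- `X = X₁ ⊕ X₂`. -/
def IsDirectSum (X X₁ X₂ : QRep Q k) : Prop :=
  ∃ (ι₁ : X₁ ⟶ X) (ι₂ : X₂ ⟶ X) (π₁ : X ⟶ X₁) (π₂ : X ⟶ X₂),
    π₁ ≫ ι₁ + π₂ ≫ ι₂ = 𝟙 X ∧ ι₁ ≫ π₁ = 𝟙 X₁ ∧ ι₂ ≫ π₂ = 𝟙 X₂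

/-- Indecomposable finite dimensional representations. -/
structure IsIndec (X : QRep Q k) : Prop where
  finDim : X.FinDim
  nonzero : ¬ X.IsZeroRep
  indec : ∀ X₁ X₂ : QRep Q k, X.IsDirectSum X₁ X₂ → X₁.IsZeroRep ∨ X₂.IsZeroRep

/-! ### Radical and irreducible morphisms, in the category of finite dimensional representations -/

/-- `Rad(X, Y)`. -/
def rad (X Y : QRep Q k) : Set (X ⟶ Y) :=
  {φ | ∀ (Z : QRep Q k), Z.IsIndec → ∀ (σ : Z ⟶ X) (τ : Y ⟶ Z), ¬ IsIso (σ ≫ φ ≫ τ)}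

/-- `Rad^n(X, Y)`. -/
def radPow : ℕ → (X Y : QRep Q k) → Set (X ⟶ Y)
  | 0, _, _ => Set.univ
  | n + 1, X, Y => {φ | ∃ (Z : QRep Q k) (φ' : X ⟶ Z) (φ'' : Z ⟶ Y),
      Z.FinDim ∧ φ' ∈ rad X Z ∧ φ'' ∈ radPow n Z Y ∧ φ = φ' ≫ φ''}

structure IsIrreducible {X Y : QRep Q k} (φ : X ⟶ Y) : Prop where
  not_splitMono : ¬ IsSplitMono φ
  not_splitEpi : ¬ IsSplitEpi φ
  factor : ∀ (Z : QRep Q k), Z.FinDim → ∀ (φ' : X ⟶ Z) (φ'' : Z ⟶ Y),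
    φ = φ' ≫ φ'' → IsSplitMono φ' ∨ IsSplitEpi φ''

/-- Compositions of one or more irreducible morphisms between indecomposable representations. -/
inductive IsIrrComp : ∀ {X Y : QRep Q k}, (X ⟶ Y) → Prop
  | irr {X Y : QRep Q k} (φ : X ⟶ Y) (hX : X.IsIndec) (hY : Y.IsIndec)
      (hφ : IsIrreducible φ) : IsIrrComp φ
  | comp {X Y Z : QRep Q k} (φ : X ⟶ Y) (ψ : Y ⟶ Z)
      (hφ : IsIrrComp φ) (hψ : IsIrrComp ψ) : IsIrrComp (φ ≫ ψ)

/-- Finite sums of such compositions (the empty sum is `0`). -/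
def IsSumOfIrrComp {X Y : QRep Q k} (φ : X ⟶ Y) : Prop :=
  φ ∈ AddSubmonoid.closure {ψ : X ⟶ Y | IsIrrComp ψ}

/-! ### Projective representations -/

variable (Q k) in
/-- `P(i)`: the space at `j` has as a basis the paths from `i` to `j`. -/
def proj (i : V) : QRep Q k where
  sp j := ModuleCat.of k (Q.Path i j →₀ k)
  map α := Finsupp.lmapDomain k k (FinQuiver.Path.cons α)

/-! ### Reflection functors, on objects -/

/-- The identification of the spaces of `X` at two equal vertices. -/
def spCast (X : QRep Q k) {j l : V} (h : j = l) : X.sp j ≃ₗ[k] X.sp l :=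
  h ▸ LinearEquiv.refl k (X.sp j)

/-- The linear map of the arrow `α`, for end points given up to equality. -/
def mapOf (X : QRep Q k) (α : A) {j l : V} (hs : Q.s α = j) (ht : Q.t α = l) :
    X.sp j →ₗ[k] X.sp l :=
  (X.spCast ht).toLinearMap ∘ₗ X.map α ∘ₗ (X.spCast hs.symm).toLinearMap

/-- Representations of equal quivers are the same thing. -/
def ofEq (h : Q = Q') (X : QRep Q k) : QRep Q' k where
  sp := X.sp
  map α := X.mapOf α (by rw [h]) (by rw [h])

variable [DecidableEq V]

/-- The family of vector spaces of `X` with the one at the vertex `i` replaced by `M`. -/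
def newSp (X : QRep Q k) (i : V) (M : ModuleCat.{u} k) (j : V) : ModuleCat.{u} k :=
  if j = i then M else X.sp j

def newSpAt (X : QRep Q k) (i : V) (M : ModuleCat.{u} k) {j : V} (h : j = i) :
    X.newSp i M j ≃ₗ[k] M :=
  (show M = X.newSp i M j from (if_pos h).symm) ▸ LinearEquiv.refl k M

def newSpOff (X : QRep Q k) (i : V) (M : ModuleCat.{u} k) {j : V} (h : j ≠ i) :
    X.newSp i M j ≃ₗ[k] X.sp j :=
  (show X.sp j = X.newSp i M j from (if_neg h).symm) ▸ LinearEquiv.refl k (X.sp j)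

/-- The map `(X_α) : ⨁_{t(α) = i} X_{s(α)} → X_i`. -/
def inMap [Fintype A] (X : QRep Q k) (i : V) :
    (∀ α : {α : A // Q.t α = i}, X.sp (Q.s α)) →ₗ[k] X.sp i :=
  ∑ α : {α : A // Q.t α = i}, X.mapOf α.1 rfl α.2 ∘ₗ LinearMap.proj α

/-- The map `(X_α) : X_i → ⨁_{s(α) = i} X_{t(α)}`. -/
def outMap (X : QRep Q k) (i : V) :
    X.sp i →ₗ[k] (∀ α : {α : A // Q.s α = i}, X.sp (Q.t α)) :=
  LinearMap.pi fun α => X.mapOf α.1 α.2 rfl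

/-- `S_i^+ X` for a sink `i`: the space at `i` becomes the kernel of `inMap`, and the reversed
arrows `i → s(α)` act as the inclusion of the kernel followed by the projections. -/
def reflPlus [Fintype A] (X : QRep Q k) {i : V} (hi : Q.IsSink i) : QRep (Q.reflect i) k where
  sp := X.newSp i (ModuleCat.of k (LinearMap.ker (X.inMap i)))
  map α :=
    if h : Q.t α = i then
      (X.newSpOff i _ (by simpa [FinQuiver.reflect, h] using hi α)).symm.toLinearMap ∘ₗ
        (X.spCast (show Q.s α = (Q.reflect i).t α by simp [FinQuiver.reflect, h])).toLinearMap ∘ₗ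
        LinearMap.proj (R := k) (φ := fun β : {α : A // Q.t α = i} => X.sp (Q.s β)) ⟨α, h⟩ ∘ₗ
        (LinearMap.ker (X.inMap i)).subtype ∘ₗ
        (X.newSpAt i _ (show (Q.reflect i).s α = i by simp [FinQuiver.reflect, h])).toLinearMap
    else
      (X.newSpOff i _ (by simp [FinQuiver.reflect, h, hi α])).symm.toLinearMap ∘ₗ
        X.mapOf α (by simp [FinQuiver.reflect, h, hi α]) (by simp [FinQuiver.reflect, h, hi α]) ∘ₗ
        (X.newSpOff i _ (by simp [FinQuiver.reflect, h, hi α])).toLinearMap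

/-- `S_i^- X` for a source `i`: the space at `i` becomes the cokernel of `outMap`, and the reversed
arrows `t(α) → i` act as the inclusions into the direct sum followed by the map onto the
cokernel. -/
def reflMinus [DecidableEq A] (X : QRep Q k) {i : V} (hi : Q.IsSource i) :
    QRep (Q.reflect i) k where
  sp := X.newSp i (ModuleCat.of k
    ((∀ α : {α : A // Q.s α = i}, X.sp (Q.t α)) ⧸ LinearMap.range (X.outMap i)))
  map α :=
    if h : Q.s α = i then
      (X.newSpAt i _ (show (Q.reflect i).t α = i by simp [FinQuiver.reflect, h])).symm.toLinearMap ∘ₗ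
        (LinearMap.range (X.outMap i)).mkQ ∘ₗ
        LinearMap.single k (fun β : {α : A // Q.s α = i} => X.sp (Q.t β)) ⟨α, h⟩ ∘ₗ
        (X.spCast (show (Q.reflect i).s α = Q.t α by simp [FinQuiver.reflect, h])).toLinearMap ∘ₗ
        (X.newSpOff i _ (by simpa [FinQuiver.reflect, h] using hi α)).toLinearMap
    else
      (X.newSpOff i _ (by simp [FinQuiver.reflect, h, hi α])).symm.toLinearMap ∘ₗ
        X.mapOf α (by simp [FinQuiver.reflect, h, hi α]) (by simp [FinQuiver.reflect, h, hi α]) ∘ₗ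
        (X.newSpOff i _ (by simp [FinQuiver.reflect, h, hi α])).toLinearMap

/-! ### Coxeter functors, on objects -/

/-- `S_{i_n}^+ ⋯ S_{i_1}^+` for the list `[i_1, …, i_n]`. -/
def plusAlong [Fintype A] : (L : List V) → (Q : FinQuiver V A) → Q.SinkSequence L →
    QRep Q k → QRep (Q.reflectList L) k
  | [], _, _, X => X
  | i :: L, Q, h, X => plusAlong L (Q.reflect i) h.2 (X.reflPlus h.1)

/-- `S_{i_1}^- ⋯ S_{i_n}^-` for the list `[i_1, …, i_n]`. -/
def minusAlong [DecidableEq A] : (L : List V) → (Q : FinQuiver V A) → Q.SinkSequence L →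
    QRep (Q.reflectList L) k → QRep Q k
  | [], _, _, X => X
  | i :: L, Q, h, X =>
      ((minusAlong L (Q.reflect i) h.2 X).reflMinus h.1.isSource_reflect).ofEq
        (Q.reflect_reflect i)

/-- `C^+` with respect to an admissible ordering. -/
def coxPlus [Fintype A] {L : List V} (hL : Q.IsAdmissible L) (X : QRep Q k) : QRep Q k :=
  (plusAlong L Q hL.sinks X).ofEq hL.reflectList_eq

/-- `C^-` with respect to an admissible ordering. -/
def coxMinus [DecidableEq A] {L : List V} (hL : Q.IsAdmissible L) (X : QRep Q k) : QRep Q k :=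
  minusAlong L Q hL.sinks (X.ofEq hL.reflectList_eq.symm)

/-- `C^r` for `r ∈ ℤ`: `(C^+)^r` for `r ≥ 0` and `(C^-)^{-r}` for `r < 0`. -/
def coxPow [Fintype A] [DecidableEq A] {L : List V} (hL : Q.IsAdmissible L) :
    ℤ → QRep Q k → QRep Q k
  | .ofNat n => (coxPlus hL)^[n]
  | .negSucc n => (coxMinus hL)^[n + 1]

end QRep

end

end QuivRep

/-!
For a sink `i`, call `X` (over `Q`) and `X'` (over `σ_i Q`) reflections of each other when they
agree off `i` and `X'_i → ⨁_{t(α) = i} X_{s(α)} → X_i` is exact. A morphism on either side then has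
a counterpart on the other side: over `σ_i Q` it is unique if the first map of the target is
injective, and over `Q` it is unique if the second map of the source is surjective.

An admissible ordering, repeated periodically, is an infinite sequence `v 0, v 1, …` of successive
sinks. Reflecting the simple representation at the sink `v a` back through `v (a - 1), …, v 0` gives
a representation `X_a` as long as it does not degenerate, and the representations `C^r P(i)` are
among these. Whatever is asserted about morphisms out of `X_a` may be checked after `a` reflections,
where `X_a` has become simple projective at a sink. There a morphism which is not a split
monomorphism is a sum of morphisms `P(i) → P(j) → Z`, one for each arrow `j → i`. Hence a morphism
out of `X_a` which is not a split monomorphism is a sum of morphisms that factor through immediate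
successors `X_c` of `X_a`, and `Hom(X_a, X_c)` is a line spanned by an irreducible morphism.

Since a Dynkin diagram is a tree, `Q` has a height function dropping by one along each arrow.
Raising the height of a vertex by two at each reflection turns it into a level of the `X_a` which
goes up by exactly one from `X_a` to its immediate successors. All chains of irreducible morphisms
from `X` to `Y` therefore have the same length `d`, so that every morphism lies in `Rad^d` and
`Rad^{d+1}` vanishes.
-/

namespace QuivRep

universe u

noncomputable section

namespace QRep

/-! ### Morphisms of representations -/

section Morphisms

variable {V A : Type} {Q : FinQuiver V A} {k : Type u} [Field k] {X Y Z : QRep Q k}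

@[simp]
theorem mapOf_rfl (X : QRep Q k) (α : A) : X.mapOf α rfl rfl = X.map α := rfl

/-- The component of a morphism at a vertex. -/
def app (φ : X ⟶ Y) (j : V) : X.sp j →ₗ[k] Y.sp j :=
  Subtype.val (p := fun f => f ∈ homSubmodule X Y) φ j

theorem hom_ext {φ ψ : X ⟶ Y} (h : ∀ j x, app φ j x = app ψ j x) : φ = ψ :=
  Subtype.ext (funext fun j => LinearMap.ext (h j))

@[simp]
theorem app_id (j : V) (x : X.sp j) : app (𝟙 X) j x = x := rfl

@[simp]
theorem app_comp (φ : X ⟶ Y) (ψ : Y ⟶ Z) (j : V) (x : X.sp j) :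
    app (φ ≫ ψ) j x = app ψ j (app φ j x) := rfl

@[simp]
theorem app_add (φ ψ : X ⟶ Y) (j : V) (x : X.sp j) :
    app (φ + ψ) j x = app φ j x + app ψ j x := rfl

@[simp]
theorem app_zero (j : V) (x : X.sp j) : app (0 : X ⟶ Y) j x = 0 := rfl

@[simp]
theorem app_smul (c : k) (φ : X ⟶ Y) (j : V) (x : X.sp j) :
    app (c • φ) j x = c • app φ j x := rfl

theorem app_sum {ι : Type*} (s : Finset ι) (f : ι → (X ⟶ Y)) (j : V) (x : X.sp j) :
    app (∑ t ∈ s, f t) j x = ∑ t ∈ s, app (f t) j x :=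
  map_sum (⟨⟨fun φ => app φ j x, rfl⟩, fun _ _ => rfl⟩ : (X ⟶ Y) →+ Y.sp j) f s

theorem app_mapOf (φ : X ⟶ Y) (α : A) {j l : V} (hs : Q.s α = j) (ht : Q.t α = l)
    (x : X.sp j) : app φ l (X.mapOf α hs ht x) = Y.mapOf α hs ht (app φ j x) := by
  subst hs ht
  exact (LinearMap.congr_fun (Subtype.prop (p := fun f => f ∈ homSubmodule X Y) φ α) x).symm

/-- The morphism with given components. -/
def homMk (f : ∀ j, X.sp j →ₗ[k] Y.sp j)
    (hf : ∀ α x, f (Q.t α) (X.map α x) = Y.map α (f (Q.s α) x)) : X ⟶ Y :=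
  ⟨f, fun α => LinearMap.ext fun x => (hf α x).symm⟩

@[simp]
theorem app_homMk (f : ∀ j, X.sp j →ₗ[k] Y.sp j)
    (hf : ∀ α x, f (Q.t α) (X.map α x) = Y.map α (f (Q.s α) x)) (j : V) :
    app (homMk f hf) j = f j := rfl

theorem exists_hom_of_isSink {i : V} (hi : Q.IsSink i) (g : X.sp i →ₗ[k] Y.sp i)
    (f : ∀ j, j ≠ i → (X.sp j →ₗ[k] Y.sp j))
    (hf : ∀ α (h : Q.t α ≠ i) x, f _ h (X.map α x) = Y.map α (f _ (hi α) x))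
    (hg : ∀ α (h : Q.t α = i) x, g (X.mapOf α rfl h x) = Y.mapOf α rfl h (f _ (hi α) x)) :
    ∃ φ : X ⟶ Y, app φ i = g ∧ ∀ j h, app φ j = f j h := by
  classical
  let F (j : V) : X.sp j →ₗ[k] Y.sp j := if h : j = i then h ▸ g else f j h
  have hFi : F i = g := by simp [F]
  have hF (j : V) (h : j ≠ i) : F j = f j h := by simp [F, h]
  refine ⟨homMk F fun α x => ?_, hFi, hF⟩
  rw [hF _ (hi α)]
  by_cases h : Q.t α = i
  · subst h
    rw [hFi]
    exact hg α rfl x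
  · rw [hF _ h, hf]

theorem exists_hom_of_isSource {i : V} (hi : Q.IsSource i) (g : X.sp i →ₗ[k] Y.sp i)
    (f : ∀ j, j ≠ i → (X.sp j →ₗ[k] Y.sp j))
    (hf : ∀ α {j l} (hs : Q.s α = j) (ht : Q.t α = l) (hj : j ≠ i) (hl : l ≠ i) x,
      f l hl (X.mapOf α hs ht x) = Y.mapOf α hs ht (f j hj x))
    (hg : ∀ α {l} (hs : Q.s α = i) (ht : Q.t α = l) (hl : l ≠ i) x,
      f l hl (X.mapOf α hs ht x) = Y.mapOf α hs ht (g x)) :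
    ∃ φ : X ⟶ Y, app φ i = g ∧ ∀ j h, app φ j = f j h := by
  classical
  let F (j : V) : X.sp j →ₗ[k] Y.sp j := if h : j = i then h ▸ g else f j h
  have hFi : F i = g := by simp [F]
  have hF (j : V) (h : j ≠ i) : F j = f j h := by simp [F, h]
  refine ⟨homMk F fun α x => ?_, hFi, hF⟩
  rw [hF _ (hi α)]
  by_cases h : Q.s α = i
  · subst h
    rw [hFi]
    exact hg α rfl rfl _ x
  · rw [hF _ h]
    exact hf α rfl rfl h _ x

/-- The component of an isomorphism at a vertex. -/
def isoApp (θ : X ≅ Y) (j : V) : X.sp j ≃ₗ[k] Y.sp j :=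
  LinearEquiv.ofLinearMap (app θ.hom j) (app θ.inv j)
    (LinearMap.ext fun x => congrArg (fun φ => app φ j x) θ.inv_hom_id)
    (LinearMap.ext fun x => congrArg (fun φ => app φ j x) θ.hom_inv_id)

@[simp]
theorem isoApp_apply (θ : X ≅ Y) (j : V) (x : X.sp j) : isoApp θ j x = app θ.hom j x := rfl

theorem IsZeroRep.eq_zero_of_src (h : X.IsZeroRep) (φ : X ⟶ Y) : φ = 0 := hom_ext fun j x => by
  have := h j
  rw [Subsingleton.elim x 0, map_zero, map_zero]

theorem IsZeroRep.eq_zero_of_tgt (h : Y.IsZeroRep) (φ : X ⟶ Y) : φ = 0 := hom_ext fun j _ => by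
  have := h j
  exact Subsingleton.elim _ _

theorem IsZeroRep.finDim (h : X.IsZeroRep) : X.FinDim := fun j => by
  have := h j
  infer_instance

theorem isZeroRep_iff_id_eq_zero : X.IsZeroRep ↔ 𝟙 X = 0 where
  mp h := h.eq_zero_of_src _
  mpr h j := subsingleton_of_forall_eq 0 fun x => congrArg (fun φ => app φ j x) h

theorem IsZeroRep.of_iso (h : X.IsZeroRep) (θ : X ≅ Y) : Y.IsZeroRep := by
  rw [isZeroRep_iff_id_eq_zero, ← θ.inv_hom_id, h.eq_zero_of_src θ.hom, Limits.comp_zero]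

end Morphisms

/-! ### Direct sums -/

section DirectSums

open Limits

variable {V A : Type} {Q : FinQuiver V A} {k : Type u} [Field k]

/-- The zero representation. -/
def zeroRep (Q : FinQuiver V A) (k : Type u) [Field k] : QRep Q k where
  sp _ := ModuleCat.of k PUnit
  map _ := 0

theorem isZeroRep_zeroRep (Q : FinQuiver V A) (k : Type u) [Field k] :
    (zeroRep Q k).IsZeroRep := fun _ => inferInstanceAs (Subsingleton PUnit)

/-- The vertexwise direct sum of two representations, with its injections and projections; it
provides the biproducts `X ⊞ Y` of representations. -/
def sumBicone (X Y : QRep Q k) : BinaryBicone X Y where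
  pt := ⟨fun j => ModuleCat.of k (X.sp j × Y.sp j), fun α => (X.map α).prodMap (Y.map α)⟩
  fst := homMk (fun j => LinearMap.fst k (X.sp j) (Y.sp j)) fun _ _ => rfl
  snd := homMk (fun j => LinearMap.snd k (X.sp j) (Y.sp j)) fun _ _ => rfl
  inl := homMk (fun j => LinearMap.inl k (X.sp j) (Y.sp j)) fun α x =>
    Prod.ext rfl (map_zero (Y.map α)).symm
  inr := homMk (fun j => LinearMap.inr k (X.sp j) (Y.sp j)) fun α x =>
    Prod.ext (map_zero (X.map α)).symm rfl

instance : HasBinaryBiproducts (QRep Q k) where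
  has_binary_biproduct X Y := hasBinaryBiproduct_of_total (sumBicone X Y) <|
    hom_ext fun _ x => Prod.ext (add_zero x.1) (zero_add x.2)

theorem FinDim.biprod {X Y : QRep Q k} (hX : X.FinDim) (hY : Y.FinDim) : (X ⊞ Y).FinDim :=
  fun j => by
    have := hX j
    have := hY j
    refine Module.Finite.of_injective
      ((app (biprod.fst : X ⊞ Y ⟶ X) j).prod (app (biprod.snd : X ⊞ Y ⟶ Y) j)) ?_
    refine (injective_iff_map_eq_zero _).2 fun x hx => ?_
    have hfst : app (biprod.fst : X ⊞ Y ⟶ X) j x = 0 := congrArg Prod.fst hx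
    have hsnd : app (biprod.snd : X ⊞ Y ⟶ Y) j x = 0 := congrArg Prod.snd hx
    calc x = app (biprod.fst ≫ biprod.inl + biprod.snd ≫ biprod.inr : X ⊞ Y ⟶ X ⊞ Y) j x := by
          rw [biprod.total, app_id]
      _ = 0 := by rw [app_add, app_comp, app_comp, hfst, hsnd, map_zero, map_zero, add_zero]

end DirectSums

/-! ### Bricks, radical and irreducible morphisms -/

section Bricks

variable {V A : Type} {Q : FinQuiver V A} {k : Type u} [Field k] {X Y Z : QRep Q k}

/-- Bricks: the representations whose endomorphisms form a line, consisting of the multiples of the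
identity. -/
def IsBrick (X : QRep Q k) : Prop := Module.finrank k (X ⟶ X) = 1

theorem IsBrick.nonzero (hX : X.IsBrick) : ¬ X.IsZeroRep := fun h => by
  have : Subsingleton (X ⟶ X) := subsingleton_of_forall_eq 0 h.eq_zero_of_src
  exact zero_ne_one (Module.finrank_zero_of_subsingleton.symm.trans hX)

theorem IsBrick.id_ne_zero (hX : X.IsBrick) : 𝟙 X ≠ 0 :=
  isZeroRep_iff_id_eq_zero.not.1 hX.nonzero

theorem IsBrick.exists_eq_smul_id (hX : X.IsBrick) (φ : X ⟶ X) : ∃ c : k, c • 𝟙 X = φ :=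
  exists_smul_eq_of_finrank_eq_one hX hX.id_ne_zero φ

theorem IsBrick.nonempty_algEquiv (hX : X.IsBrick) : Nonempty (End X ≃ₐ[k] k) := by
  have : Nontrivial (End X) := ⟨_, _, hX.id_ne_zero⟩
  have hsurj : Function.Surjective (Algebra.ofId k (End X)) := fun φ => by
    obtain ⟨c, rfl⟩ := hX.exists_eq_smul_id φ
    exact ⟨c, Algebra.algebraMap_eq_smul_one c⟩
  exact ⟨(AlgEquiv.ofBijective _ ⟨RingHom.injective (algebraMap k (End X)), hsurj⟩).symm⟩

theorem IsBrick.eq_zero_or_eq_id (hX : X.IsBrick) {φ : X ⟶ X} (hφ : φ ≫ φ = φ) :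
    φ = 0 ∨ φ = 𝟙 X := by
  obtain ⟨c, rfl⟩ := hX.exists_eq_smul_id φ
  have hc : c * c = c := by
    refine smul_left_injective k hX.id_ne_zero ?_
    simpa [mul_smul] using hφ
  rcases IsIdempotentElem.iff_eq_zero_or_one.1 hc with rfl | rfl
  · exact .inl (zero_smul k _)
  · exact .inr (one_smul k _)

theorem IsBrick.isIndec (hX : X.IsBrick) (hf : X.FinDim) : X.IsIndec where
  finDim := hf
  nonzero := hX.nonzero
  indec X₁ X₂ := by
    rintro ⟨ι₁, ι₂, π₁, π₂, h, h₁, h₂⟩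
    simp only [isZeroRep_iff_id_eq_zero]
    rcases hX.eq_zero_or_eq_id (φ := π₁ ≫ ι₁) (by simp [reassoc_of% h₁]) with h0 | hid
    · left
      calc 𝟙 X₁ = ι₁ ≫ (π₁ ≫ ι₁) ≫ π₁ := by simp [h₁]
        _ = 0 := by simp [h0]
    · right
      have h0 : π₂ ≫ ι₂ = 0 := by simpa [hid] using h
      calc 𝟙 X₂ = ι₂ ≫ (π₂ ≫ ι₂) ≫ π₂ := by simp [h₂]
        _ = 0 := by simp [h0]

theorem mem_rad_of_hom_eq_zero (h : ∀ ρ : Y ⟶ X, ρ = 0) (φ : X ⟶ Y) : φ ∈ rad X Y := by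
  intro Z hZ σ τ hi
  refine hZ.nonzero (isZeroRep_iff_id_eq_zero.2 ?_)
  have h0 := h (τ ≫ inv (σ ≫ φ ≫ τ) ≫ σ)
  calc 𝟙 Z = (σ ≫ φ ≫ τ) ≫ inv (σ ≫ φ ≫ τ) ≫ (σ ≫ φ ≫ τ) ≫ inv (σ ≫ φ ≫ τ) := by
        rw [IsIso.hom_inv_id, Category.comp_id, IsIso.hom_inv_id]
    _ = σ ≫ φ ≫ (τ ≫ inv (σ ≫ φ ≫ τ) ≫ σ) ≫ φ ≫ τ ≫ inv (σ ≫ φ ≫ τ) := by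
        simp only [Category.assoc]
    _ = 0 := by rw [h0, Limits.zero_comp, Limits.comp_zero, Limits.comp_zero]

theorem not_isSplitMono_of_mem_rad (hX : X.IsIndec) {φ : X ⟶ Y} (hφ : φ ∈ rad X Y) :
    ¬ IsSplitMono φ := by
  intro h
  apply hφ X hX (𝟙 X) (retraction φ)
  rw [IsSplitMono.id, Category.comp_id]
  infer_instance

theorem comp_mem_rad (ψ : X ⟶ Y) {φ : Y ⟶ Z} (hφ : φ ∈ rad Y Z) : ψ ≫ φ ∈ rad X Z :=
  fun W hW σ τ => by simpa only [Category.assoc] using hφ W hW (σ ≫ ψ) τ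

theorem comp_mem_radPow (ψ : X ⟶ Y) {m : ℕ} {φ : Y ⟶ Z} (hφ : φ ∈ radPow m Y Z) :
    ψ ≫ φ ∈ radPow m X Z := by
  cases m with
  | zero => trivial
  | succ m =>
    obtain ⟨W, φ', φ'', hW, h', h'', rfl⟩ := hφ
    exact ⟨W, ψ ≫ φ', φ'', hW, comp_mem_rad ψ h', h'', (Category.assoc _ _ _).symm⟩

theorem zero_mem_radPow (m : ℕ) (X Y : QRep Q k) : (0 : X ⟶ Y) ∈ radPow m X Y := by
  induction m generalizing X with
  | zero => trivial
  | succ m ih =>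
    have hzero := isZeroRep_zeroRep Q k
    exact ⟨zeroRep Q k, 0, 0, hzero.finDim, mem_rad_of_hom_eq_zero hzero.eq_zero_of_src 0, ih _,
      Limits.comp_zero.symm⟩

theorem radPow_antitone (X Y : QRep Q k) : Antitone fun m => radPow m X Y := by
  refine antitone_nat_of_succ_le fun m => ?_
  induction m generalizing X with
  | zero => exact Set.subset_univ _
  | succ m ih =>
    rintro φ ⟨W, φ', φ'', hW, h', h'', rfl⟩
    exact ⟨W, φ', φ'', hW, h', ih W h'', rfl⟩

/-- A strong negation of irreducibility: `φ` is a composite `f ≫ g` such that `f` followed by any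
morphism back to `X`, and any morphism out of `Y` followed by `g`, vanish. In contrast to
reducibility this is stable under sums. -/
def IsStronglyReducible (φ : X ⟶ Y) : Prop :=
  ∃ (Z : QRep Q k) (f : X ⟶ Z) (g : Z ⟶ Y), Z.FinDim ∧ φ = f ≫ g ∧
    (∀ ρ : Z ⟶ X, f ≫ ρ = 0) ∧ ∀ ρ : Y ⟶ Z, ρ ≫ g = 0

theorem isStronglyReducible_zero : IsStronglyReducible (0 : X ⟶ Y) :=
  ⟨zeroRep Q k, 0, 0, (isZeroRep_zeroRep Q k).finDim, Limits.comp_zero.symm,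
    fun _ => Limits.zero_comp, fun _ => Limits.comp_zero⟩

theorem IsStronglyReducible.add {φ ψ : X ⟶ Y} (hφ : IsStronglyReducible φ)
    (hψ : IsStronglyReducible ψ) : IsStronglyReducible (φ + ψ) := by
  obtain ⟨Z₁, f₁, g₁, hZ₁, rfl, hf₁, hg₁⟩ := hφ
  obtain ⟨Z₂, f₂, g₂, hZ₂, rfl, hf₂, hg₂⟩ := hψ
  refine ⟨Z₁ ⊞ Z₂, Limits.biprod.lift f₁ f₂, Limits.biprod.desc g₁ g₂, hZ₁.biprod hZ₂,
    Limits.biprod.lift_desc.symm, fun ρ => ?_, fun ρ => ?_⟩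
  · rw [Limits.biprod.lift_eq, Preadditive.add_comp, Category.assoc, Category.assoc, hf₁, hf₂,
      add_zero]
  · rw [Limits.biprod.desc_eq, Preadditive.comp_add, ← Category.assoc, ← Category.assoc, hg₁, hg₂,
      add_zero]

theorem IsStronglyReducible.not_isIrreducible (hX : ¬ X.IsZeroRep) (hY : ¬ Y.IsZeroRep)
    {φ : X ⟶ Y} (hφ : IsStronglyReducible φ) : ¬ IsIrreducible φ := by
  obtain ⟨Z, f, g, hZ, hfg, hf, hg⟩ := hφ
  rw [isZeroRep_iff_id_eq_zero] at hX hY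
  intro hirr
  rcases hirr.factor Z hZ f g hfg with h | h
  · exact hX (by rw [← IsSplitMono.id f, hf])
  · exact hY (by rw [← IsSplitEpi.id g, hg])

theorem IsIrreducible.ne_zero (hX : ¬ X.IsZeroRep) (hY : ¬ Y.IsZeroRep) {φ : X ⟶ Y}
    (hφ : IsIrreducible φ) : φ ≠ 0 := by
  rintro rfl
  exact isStronglyReducible_zero.not_isIrreducible hX hY hφ

/-- The third condition for irreducibility, with respect to all representations, whether finite
dimensional or not. -/
def FactorsTrivially (φ : X ⟶ Y) : Prop :=
  ∀ (Z : QRep Q k) (φ' : X ⟶ Z) (φ'' : Z ⟶ Y), φ = φ' ≫ φ'' → IsSplitMono φ' ∨ IsSplitEpi φ''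

theorem FactorsTrivially.isIrreducible {φ : X ⟶ Y} (hφ : FactorsTrivially φ)
    (hmono : ¬ IsSplitMono φ) (hepi : ¬ IsSplitEpi φ) : IsIrreducible φ :=
  ⟨hmono, hepi, fun Z _ => hφ Z⟩

theorem IsIrrComp.comp_isSumOfIrrComp {φ : X ⟶ Y} {ψ : Y ⟶ Z} (hφ : IsIrrComp φ)
    (hψ : IsSumOfIrrComp ψ) : IsSumOfIrrComp (φ ≫ ψ) := by
  induction hψ using AddSubmonoid.closure_induction with
  | zero => rw [Limits.comp_zero]; exact AddSubmonoid.zero_mem _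
  | add f g _ _ hf hg => rw [Preadditive.comp_add]; exact AddSubmonoid.add_mem _ hf hg
  | mem f hf => exact AddSubmonoid.subset_closure (.comp _ _ hφ hf)

end Bricks

end QRep

namespace FinQuiver

variable {V A : Type} {Q : FinQuiver V A} {h : V → ℤ} {i j l : V}

/-- A grading of the vertices for which each arrow goes down by one step. -/
def IsHeight (Q : FinQuiver V A) (h : V → ℤ) : Prop := ∀ α, h (Q.s α) = h (Q.t α) + 1

/-- `Q` has no parallel arrows. -/
def IsSimple (Q : FinQuiver V A) : Prop := ∀ ⦃α β⦄, Q.s α = Q.s β → Q.t α = Q.t β → α = β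

theorem IsSink.path_eq (hi : Q.IsSink i) (p : Q.Path i j) : ∃ h : i = j, p = h ▸ Path.nil := by
  induction p with
  | nil => exact ⟨rfl, rfl⟩
  | cons α p ih =>
    obtain ⟨h, -⟩ := ih
    exact absurd h.symm (hi α)

theorem IsHeight.path_le (hh : Q.IsHeight h) (p : Q.Path j l) : h l ≤ h j := by
  induction p with
  | nil => rfl
  | cons α _ ih => have := hh α; omega

end FinQuiver

namespace QRep

open FinQuiver

/-! ### Projective representations -/

section Projective

variable {V A : Type} {Q : FinQuiver V A} {k : Type u} [Field k] {X Y : QRep Q k} {i j : V}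

/-- The universal elements `x`, for which `φ ↦ φ(x)` is a bijection `Hom(X, Z) → Z_j` for all
representations `Z`. -/
def IsUniversal (x : X.sp j) : Prop := ∀ (Z : QRep Q k) (z : Z.sp j), ∃! φ : X ⟶ Z, app φ j x = z

/-- The representations isomorphic to `P(j)`, which are those representing the functor
`Z ↦ Z_j`. -/
def IsProj (X : QRep Q k) (j : V) : Prop := ∃ x : X.sp j, IsUniversal x

theorem IsUniversal.hom_ext {x : X.sp j} (hx : IsUniversal x) {φ ψ : X ⟶ Y}
    (h : app φ j x = app ψ j x) : φ = ψ :=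
  (hx Y _).unique h rfl

/-- Evaluation at a universal element. -/
def IsUniversal.homEquiv {x : X.sp j} (hx : IsUniversal x) (Y : QRep Q k) :
    (X ⟶ Y) ≃ₗ[k] Y.sp j :=
  LinearEquiv.ofBijective ⟨⟨fun φ => app φ j x, fun _ _ => rfl⟩, fun _ _ => rfl⟩
    ⟨fun _ _ h => hx.hom_ext h, fun y => (hx Y y).exists⟩

theorem IsProj.nonempty_iso (hX : X.IsProj j) (hY : Y.IsProj j) : Nonempty (X ≅ Y) := by
  obtain ⟨x, hx⟩ := hX
  obtain ⟨y, hy⟩ := hY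
  obtain ⟨φ, hφ, -⟩ := hx Y y
  obtain ⟨ψ, hψ, -⟩ := hy X x
  exact ⟨⟨φ, ψ, hx.hom_ext (by simp [hφ, hψ]), hy.hom_ext (by simp [hφ, hψ])⟩⟩

theorem IsProj.of_iso (hX : X.IsProj j) (θ : X ≅ Y) : Y.IsProj j := by
  obtain ⟨x, hx⟩ := hX
  refine ⟨app θ.hom j x, fun Z z => ?_⟩
  obtain ⟨φ, hφ, -⟩ := hx Z z
  refine ⟨θ.inv ≫ φ, ?_, fun ψ hψ => ?_⟩
  · calc app (θ.inv ≫ φ) j (app θ.hom j x) = app (θ.hom ≫ θ.inv ≫ φ) j x := rfl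
      _ = z := by rw [θ.hom_inv_id_assoc, hφ]
  · rw [← hx.hom_ext (φ := θ.hom ≫ ψ) (hψ.trans hφ.symm), θ.inv_hom_id_assoc]

/-- The action of a path on a representation. -/
def pathMap (Z : QRep Q k) {i : V} : ∀ {j : V}, Q.Path i j → (Z.sp i →ₗ[k] Z.sp j)
  | _, .nil => LinearMap.id
  | _, .cons α p => Z.map α ∘ₗ Z.pathMap p

/-- The basis of `P(i)_j` consisting of the paths from `i` to `j`. -/
def pathBasis (Q : FinQuiver V A) (k : Type u) [Field k] (i j : V) :
    Module.Basis (Q.Path i j) k ((proj Q k i).sp j) :=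
  (Finsupp.basisSingleOne : Module.Basis (Q.Path i j) k (Q.Path i j →₀ k))

theorem map_pathBasis (α : A) (p : Q.Path i (Q.s α)) :
    (proj Q k i).map α (pathBasis Q k i _ p) = pathBasis Q k i _ (.cons α p) := by
  simp only [pathBasis]
  exact Finsupp.mapDomain_single

theorem app_pathBasis {Z : QRep Q k} (φ : proj Q k i ⟶ Z) (p : Q.Path i j) :
    app φ j (pathBasis Q k i j p) = Z.pathMap p (app φ i (pathBasis Q k i i .nil)) := by
  induction p with
  | nil => rfl
  | cons α p ih =>
    rw [← map_pathBasis, ← mapOf_rfl, app_mapOf, ih]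
    rfl

theorem isUniversal_pathBasis_nil (Q : FinQuiver V A) (k : Type u) [Field k] (i : V) :
    IsUniversal (pathBasis Q k i i .nil) := by
  intro Z z
  let f (j : V) : (proj Q k i).sp j →ₗ[k] Z.sp j :=
    (pathBasis Q k i j).constr k fun p => Z.pathMap p z
  have hf (α : A) : f (Q.t α) ∘ₗ (proj Q k i).map α = Z.map α ∘ₗ f (Q.s α) :=
    (pathBasis Q k i _).ext fun p => by
      simp only [f, LinearMap.comp_apply, map_pathBasis, Module.Basis.constr_basis, pathMap]
  refine ⟨homMk f fun α => LinearMap.congr_fun (hf α), (pathBasis Q k i i).constr_basis k _ _,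
    fun φ hφ => QRep.hom_ext fun j => LinearMap.congr_fun ((pathBasis Q k i j).ext fun p => ?_)⟩
  rw [app_pathBasis, hφ, app_homMk, Module.Basis.constr_basis]

theorem isProj_proj (Q : FinQuiver V A) (k : Type u) [Field k] (i : V) :
    (proj Q k i).IsProj i :=
  ⟨_, isUniversal_pathBasis_nil Q k i⟩

theorem IsUniversal.span_range_pathMap {y : Y.sp j} (hy : IsUniversal y) (l : V) :
    Submodule.span k (Set.range fun p : Q.Path j l => Y.pathMap p y) = ⊤ := by
  obtain ⟨ψ, hψ, -⟩ := isUniversal_pathBasis_nil Q k j Y y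
  obtain ⟨φ, hφ, -⟩ := hy (proj Q k j) (pathBasis Q k j j .nil)
  have hφψ : φ ≫ ψ = 𝟙 Y := hy.hom_ext (by simp [hφ, hψ])
  have hsurj : Function.Surjective (app ψ l) := fun x =>
    ⟨app φ l x, congrArg (fun ρ => app ρ l x) hφψ⟩
  have hrange : (Set.range fun p : Q.Path j l => Y.pathMap p y) =
      app ψ l '' Set.range (pathBasis Q k j l) := by
    rw [← Set.range_comp]
    exact congrArg Set.range (funext fun p => by rw [Function.comp_apply, app_pathBasis, hψ])
  rw [hrange, Submodule.span_image, Module.Basis.span_eq, Submodule.map_top,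
    LinearMap.range_eq_top.2 hsurj]

theorem IsUniversal.map_ne_zero {α : A} {y : Y.sp (Q.s α)} (hy : IsUniversal y) :
    Y.map α y ≠ 0 := by
  intro h0
  obtain ⟨φ, hφ, -⟩ := hy (proj Q k (Q.s α)) (pathBasis Q k _ _ .nil)
  have h1 := app_mapOf φ α rfl rfl y
  rw [mapOf_rfl, mapOf_rfl, h0, map_zero, hφ, map_pathBasis] at h1
  exact (pathBasis Q k _ _).ne_zero _ h1.symm

end Projective

/-! ### Simple representations at a sink -/

section Simple

variable {V A : Type} {Q : FinQuiver V A} {k : Type u} [Field k] {X Y Z : QRep Q k} {i : V}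

/-- The simple representations concentrated at the vertex `i`. -/
structure IsSimpleAt (X : QRep Q k) (i : V) : Prop where
  subsingleton : ∀ j, j ≠ i → Subsingleton (X.sp j)
  finrank_eq_one : Module.finrank k (X.sp i) = 1

theorem IsSimpleAt.of_iso (hX : X.IsSimpleAt i) (θ : X ≅ Y) : Y.IsSimpleAt i where
  subsingleton j hj := by
    have := hX.subsingleton j hj
    exact (isoApp θ j).symm.injective.subsingleton
  finrank_eq_one := by rw [← (isoApp θ i).finrank_eq, hX.finrank_eq_one]

theorem IsSimpleAt.finDim (hX : X.IsSimpleAt i) : X.FinDim := fun j => by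
  by_cases hj : j = i
  · subst hj
    exact Module.finite_of_finrank_eq_succ hX.finrank_eq_one
  · have := hX.subsingleton j hj
    infer_instance

theorem IsSimpleAt.exists_ne_zero (hX : X.IsSimpleAt i) : ∃ x : X.sp i, x ≠ 0 := by
  have : Nontrivial (X.sp i) :=
    Module.nontrivial_of_finrank_pos (hX.finrank_eq_one ▸ Nat.zero_lt_one)
  exact exists_ne 0

theorem IsSimpleAt.isUniversal (hX : X.IsSimpleAt i) (hi : Q.IsSink i) {x : X.sp i}
    (hx : x ≠ 0) : IsUniversal x := by
  intro Z z
  obtain ⟨g, -, hg⟩ := LinearMap.exists_extend_of_notMem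
    (0 : (⊥ : Submodule k (X.sp i)) →ₗ[k] Z.sp i) (mt (Submodule.mem_bot k).1 hx) z
  obtain ⟨φ, hφ, -⟩ := exists_hom_of_isSink hi g (fun _ _ => 0) (by simp) fun α h y => by
    have := hX.subsingleton _ (hi α)
    rw [Subsingleton.elim y 0, map_zero, map_zero, map_zero, map_zero]
  have hφx : app φ i x = z := by rw [hφ, hg]
  refine ⟨φ, hφx, fun ψ hψ => QRep.hom_ext fun j y => ?_⟩
  by_cases hj : j = i
  · subst hj
    obtain ⟨c, rfl⟩ := exists_smul_eq_of_finrank_eq_one hX.finrank_eq_one hx y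
    rw [map_smul, map_smul, hψ, hφx]
  · have := hX.subsingleton j hj
    rw [Subsingleton.elim y 0, map_zero, map_zero]

theorem IsSimpleAt.isProj (hX : X.IsSimpleAt i) (hi : Q.IsSink i) : X.IsProj i :=
  let ⟨x, hx⟩ := hX.exists_ne_zero
  ⟨x, hX.isUniversal hi hx⟩

theorem IsSimpleAt.isBrick (hX : X.IsSimpleAt i) (hi : Q.IsSink i) : X.IsBrick := by
  obtain ⟨x, hx⟩ := hX.isProj hi
  exact (hx.homEquiv X).finrank_eq.trans hX.finrank_eq_one

theorem isSimpleAt_proj (hi : Q.IsSink i) : (proj Q k i).IsSimpleAt i where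
  subsingleton j hj := by
    have : IsEmpty (Q.Path i j) := ⟨fun p => hj (hi.path_eq p).1.symm⟩
    exact (pathBasis Q k i j).repr.injective.subsingleton
  finrank_eq_one := by
    have : Unique (Q.Path i i) := ⟨⟨.nil⟩, fun p => (hi.path_eq p).2⟩
    rw [Module.finrank_eq_nat_card_basis (pathBasis Q k i i), Nat.card_unique]

theorem IsProj.isSimpleAt {i : V} (hX : X.IsProj i) (hi : Q.IsSink i) : X.IsSimpleAt i := by
  obtain ⟨θ⟩ := (isProj_proj Q k i).nonempty_iso hX
  exact (isSimpleAt_proj hi).of_iso θ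

end Simple

section InMap

variable {V A : Type} [DecidableEq V] [Fintype A] {Q : FinQuiver V A} {k : Type u} [Field k]
  {X Y Z : QRep Q k} {i : V}

theorem inMap_apply (X : QRep Q k) (y : ∀ α : {α : A // Q.t α = i}, X.sp (Q.s α)) :
    X.inMap i y = ∑ α : {α : A // Q.t α = i}, X.mapOf α.1 rfl α.2 (y α) := by
  simp only [inMap, LinearMap.sum_apply, LinearMap.comp_apply, LinearMap.proj_apply]

theorem inMap_single [DecidableEq A] (X : QRep Q k) (α : {α : A // Q.t α = i})
    (x : X.sp (Q.s α)) : X.inMap i (Pi.single α x) = X.mapOf α.1 rfl α.2 x := by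
  rw [inMap_apply, Finset.sum_eq_single_of_mem α (Finset.mem_univ α) fun β _ h => by
    rw [Pi.single_eq_of_ne h, map_zero], Pi.single_eq_same]

theorem app_inMap (φ : X ⟶ Y) (y : ∀ α : {α : A // Q.t α = i}, X.sp (Q.s α)) :
    app φ i (X.inMap i y) = Y.inMap i fun α => app φ _ (y α) := by
  rw [inMap_apply, inMap_apply, map_sum]
  exact Finset.sum_congr rfl fun α _ => app_mapOf φ _ _ _ _

theorem IsSimpleAt.isSplitMono_or_mem_range_inMap (hX : X.IsSimpleAt i) (hi : Q.IsSink i)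
    (φ : X ⟶ Z) : IsSplitMono φ ∨ ∀ x, app φ i x ∈ LinearMap.range (Z.inMap i) := by
  classical
  obtain ⟨x, hx⟩ := hX.exists_ne_zero
  by_cases hz : app φ i x ∈ LinearMap.range (Z.inMap i)
  · refine Or.inr fun y => ?_
    obtain ⟨c, rfl⟩ := exists_smul_eq_of_finrank_eq_one hX.finrank_eq_one hx y
    rw [map_smul]
    exact Submodule.smul_mem _ _ hz
  · left
    obtain ⟨g, hrange, hg⟩ := LinearMap.exists_extend_of_notMem
      (0 : LinearMap.range (Z.inMap i) →ₗ[k] X.sp i) hz x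
    obtain ⟨ρ, hρ, -⟩ := exists_hom_of_isSink hi g (fun _ _ => 0) (by simp) fun α h y => by
      have hmem : Z.mapOf α rfl h y ∈ LinearMap.range (Z.inMap i) :=
        ⟨_, inMap_single Z ⟨α, h⟩ y⟩
      exact (LinearMap.congr_fun hrange ⟨_, hmem⟩).trans (map_zero _).symm
    refine ⟨⟨⟨ρ, (hX.isUniversal hi hx).hom_ext ?_⟩⟩⟩
    rw [app_comp, hρ, hg, app_id]

theorem IsSimpleAt.hom_eq_zero (hY : Y.IsSimpleAt i) (hi : Q.IsSink i)
    (hX : Function.Surjective (X.inMap i)) (φ : X ⟶ Y) : φ = 0 := by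
  refine QRep.hom_ext fun j x => ?_
  by_cases hj : j = i
  · subst hj
    obtain ⟨y, rfl⟩ := hX x
    rw [app_inMap, app_zero, inMap_apply]
    refine Finset.sum_eq_zero fun α _ => ?_
    have := hY.subsingleton _ (hi α)
    rw [Subsingleton.elim (app φ _ (y α)) 0, map_zero]
  · have := hY.subsingleton j hj
    exact Subsingleton.elim _ _

end InMap

/-! ### Projective representations of a graded quiver -/

section Graded

variable {V A : Type} {Q : FinQuiver V A} {k : Type u} [Field k] {X Y : QRep Q k} {h : V → ℤ}
  {i j l : V}

theorem pathMap_of_height_eq (hh : Q.IsHeight h) (p : Q.Path j l) (hl : h j = h l) :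
    ∃ e : j = l, ∀ (Y : QRep Q k) (y : Y.sp j), Y.pathMap p y = Y.spCast e y := by
  cases p with
  | nil => exact ⟨rfl, fun _ _ => rfl⟩
  | cons α p =>
    have := hh.path_le p
    have := hh α
    omega

theorem pathMap_of_height_eq_add_one (hh : Q.IsHeight h) (p : Q.Path j l) (hl : h j = h l + 1) :
    ∃ (α : A) (hs : Q.s α = j) (ht : Q.t α = l), ∀ (Y : QRep Q k) (y : Y.sp j),
      Y.pathMap p y = Y.mapOf α hs ht y := by
  cases p with
  | nil => omega
  | cons α p =>
    obtain ⟨e, he⟩ := pathMap_of_height_eq (k := k) hh p (by have := hh α; omega)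
    exact ⟨α, e.symm, rfl, fun Y y => by rw [pathMap, LinearMap.comp_apply, he]; rfl⟩

theorem IsUniversal.exists_smul_eq (hh : Q.IsHeight h) {y : Y.sp j} (hy : IsUniversal y)
    (w : Y.sp j) : ∃ c : k, c • y = w := by
  have hsub : (Set.range fun p : Q.Path j j => Y.pathMap p y) ⊆ {y} := by
    rintro _ ⟨p, rfl⟩
    obtain ⟨_, he⟩ := pathMap_of_height_eq (k := k) hh p rfl
    exact he Y y
  refine Submodule.mem_span_singleton.1 (Submodule.span_mono hsub ?_)
  rw [hy.span_range_pathMap]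
  trivial

theorem IsUniversal.exists_smul_map_eq (hh : Q.IsHeight h) (hsimple : Q.IsSimple) {α : A}
    {y : Y.sp (Q.s α)} (hy : IsUniversal y) (w : Y.sp (Q.t α)) : ∃ c : k, c • Y.map α y = w := by
  have hsub : (Set.range fun p : Q.Path (Q.s α) (Q.t α) => Y.pathMap p y) ⊆ {Y.map α y} := by
    rintro _ ⟨p, rfl⟩
    obtain ⟨β, hs, ht, hβ⟩ := pathMap_of_height_eq_add_one (k := k) hh p (hh α)
    obtain rfl : β = α := hsimple hs ht
    exact hβ Y y
  refine Submodule.mem_span_singleton.1 (Submodule.span_mono hsub ?_)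
  rw [hy.span_range_pathMap]
  trivial

theorem IsUniversal.subsingleton_of_height_eq (hh : Q.IsHeight h) {y : Y.sp j}
    (hy : IsUniversal y) (hl : h j = h l) (hjl : j ≠ l) : Subsingleton (Y.sp l) := by
  have : IsEmpty (Q.Path j l) := ⟨fun p => hjl (pathMap_of_height_eq (k := k) hh p hl).1⟩
  rw [← Submodule.subsingleton_iff k, ← subsingleton_iff_bot_eq_top, ← hy.span_range_pathMap,
    Set.range_eq_empty, Submodule.span_empty]

theorem IsProj.finrank_sp_target (hh : Q.IsHeight h) (hsimple : Q.IsSimple) {α : A}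
    (hY : Y.IsProj (Q.s α)) : Module.finrank k (Y.sp (Q.t α)) = 1 := by
  obtain ⟨y, hy⟩ := hY
  exact finrank_eq_one (Y.map α y) hy.map_ne_zero (hy.exists_smul_map_eq hh hsimple)

theorem IsSimpleAt.finrank_hom_isProj (hh : Q.IsHeight h) (hsimple : Q.IsSimple)
    (hX : X.IsSimpleAt i) (hi : Q.IsSink i) {α : A} (hα : Q.t α = i) (hY : Y.IsProj (Q.s α)) :
    Module.finrank k (X ⟶ Y) = 1 := by
  subst hα
  obtain ⟨x, hx⟩ := hX.isProj hi
  rw [(hx.homEquiv Y).finrank_eq, hY.finrank_sp_target hh hsimple]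

theorem IsSimpleAt.factorsTrivially [Finite A] (hh : Q.IsHeight h) (hsimple : Q.IsSimple)
    (hX : X.IsSimpleAt i) (hi : Q.IsSink i) {α : A} (hα : Q.t α = i) (hY : Y.IsProj (Q.s α))
    {φ : X ⟶ Y} (hφ : φ ≠ 0) : FactorsTrivially φ := by
  classical
  have := Fintype.ofFinite A
  subst hα
  obtain ⟨x, hx⟩ := hX.isProj hi
  obtain ⟨y, hy⟩ := hY
  rintro Z φ' φ'' rfl
  refine (hX.isSplitMono_or_mem_range_inMap hi φ').imp_right fun hrange => ?_
  obtain ⟨w, hw⟩ := hrange x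
  -- The space of `Y` at the source of any other arrow into the sink is zero.
  have hφx : app (φ' ≫ φ'') _ x = Y.map α (app φ'' _ (w ⟨α, rfl⟩)) := by
    rw [app_comp, ← hw, app_inMap, inMap_apply,
      Finset.sum_eq_single_of_mem ⟨α, rfl⟩ (Finset.mem_univ _)]
    · rfl
    · intro β _ hβ
      have hs : Q.s α ≠ Q.s β := fun h => hβ (Subtype.ext (hsimple h.symm β.2))
      have := hy.subsingleton_of_height_eq hh (by rw [hh, hh, β.2]) hs
      rw [Subsingleton.elim (app φ'' _ (w β)) 0, map_zero]
  obtain ⟨c, hc⟩ := hy.exists_smul_eq hh (app φ'' _ (w ⟨α, rfl⟩))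
  have hc0 : c ≠ 0 := by
    rintro rfl
    exact hφ (hx.hom_ext (by rw [hφx, ← hc, zero_smul, map_zero, app_zero]))
  obtain ⟨σ, hσ, -⟩ := hy Z (c⁻¹ • w ⟨α, rfl⟩)
  exact ⟨⟨⟨σ, hy.hom_ext (by
    rw [app_comp, hσ, map_smul, ← hc, smul_smul, inv_mul_cancel₀ hc0, one_smul, app_id])⟩⟩⟩

end Graded

end QRep

/-! ### Reflections as a relation -/

namespace FinQuiver

variable {V A : Type} [DecidableEq V] {Q : FinQuiver V A} {i : V} {α : A}

theorem reflect_s_of_t (h : Q.t α = i) : (Q.reflect i).s α = i := by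
  simp [reflect, h]

theorem reflect_t_of_t (h : Q.t α = i) : (Q.reflect i).t α = Q.s α := by
  simp [reflect, h]

theorem IsSink.reflect_s_of_ne (hi : Q.IsSink i) (h : Q.t α ≠ i) :
    (Q.reflect i).s α = Q.s α := by
  simp [reflect, h, hi α]

theorem IsSink.reflect_t_of_ne (hi : Q.IsSink i) (h : Q.t α ≠ i) :
    (Q.reflect i).t α = Q.t α := by
  simp [reflect, h, hi α]

theorem IsSink.reflect_s_eq_iff (hi : Q.IsSink i) : (Q.reflect i).s α = i ↔ Q.t α = i := by
  refine ⟨fun h => ?_, reflect_s_of_t⟩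
  by_contra h'
  exact hi α ((hi.reflect_s_of_ne h').symm.trans h)

end FinQuiver

section LinearExtension

variable {k E F G : Type*} [Field k] [AddCommGroup E] [AddCommGroup F] [AddCommGroup G]
  [Module k E] [Module k F] [Module k G]

theorem exists_comp_eq_of_ker_le (f : E →ₗ[k] F) (g : E →ₗ[k] G)
    (h : LinearMap.ker f ≤ LinearMap.ker g) : ∃ l : F →ₗ[k] G, l ∘ₗ f = g := by
  obtain ⟨l, hl⟩ :=
    ((LinearMap.ker f).liftQ g h ∘ₗ f.quotKerEquivRange.symm.toLinearMap).exists_extend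
  refine ⟨l, LinearMap.ext fun x => (LinearMap.congr_fun hl (f.rangeRestrict x)).trans ?_⟩
  have hx : f.quotKerEquivRange.symm (f.rangeRestrict x) = (LinearMap.ker f).mkQ x :=
    f.quotKerEquivRange.symm_apply_eq.2 rfl
  rw [LinearMap.comp_apply, LinearEquiv.coe_coe, hx, Submodule.mkQ_apply, Submodule.liftQ_apply]

theorem exists_comp_eq_of_range_le (f : F →ₗ[k] G) (g : E →ₗ[k] G)
    (h : LinearMap.range g ≤ LinearMap.range f) : ∃ l : E →ₗ[k] F, f ∘ₗ l = g := by
  obtain ⟨l, hl⟩ := Module.projective_lifting_property f.rangeRestrict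
    (g.codRestrict _ fun x => h ⟨x, rfl⟩) f.surjective_rangeRestrict
  exact ⟨l, LinearMap.ext fun x => congrArg Subtype.val (LinearMap.congr_fun hl x)⟩

end LinearExtension

namespace QRep

open FinQuiver

section Reflection

variable {V A : Type} [DecidableEq V] [Fintype A] {Q : FinQuiver V A} {i : V}
  {k : Type u} [Field k]

/-- A reflection between representations `X` of `Q` and `X'` of `σ_i Q`, for a sink `i`: the two
agree off `i`, and the sequence `X'_i → ⨁_{t(α) = i} X_{s(α)} → X_i` given by the arrows at `i` is
exact. Up to isomorphism `X' = S_i^+ X` if its first map is injective, and `X = S_i^- X'` if its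
second map is surjective. -/
structure Reflection (hi : Q.IsSink i) (X : QRep Q k) (X' : QRep (Q.reflect i) k) where
  equiv : ∀ j, j ≠ i → X.sp j ≃ₗ[k] X'.sp j
  map_equiv : ∀ (α : A) (h : Q.t α ≠ i) (x : X.sp (Q.s α)),
    X'.mapOf α (hi.reflect_s_of_ne h) (hi.reflect_t_of_ne h) (equiv _ (hi α) x) =
      equiv _ h (X.map α x)
  outMap : X'.sp i →ₗ[k] (∀ α : {α : A // Q.t α = i}, X.sp (Q.s α))
  equiv_outMap : ∀ (α : {α : A // Q.t α = i}) (x : X'.sp i),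
    equiv _ (hi α) (outMap x α) = X'.mapOf α.1 (reflect_s_of_t α.2) (reflect_t_of_t α.2) x
  exact : Function.Exact outMap (X.inMap i)

namespace Reflection

variable {hi : Q.IsSink i} {X Y Z : QRep Q k} {X' Y' Z' : QRep (Q.reflect i) k}

/-- `X'` is the reflection `S_i^+ X`. -/
def IsPlus (R : Reflection hi X X') : Prop := Function.Injective R.outMap

/-- `X` is the reflection `S_i^- X'`. -/
def IsMinus (_ : Reflection hi X X') : Prop := Function.Surjective (X.inMap i)

/-- The morphisms `φ` and `φ'` agree off the vertex `i`. -/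
def Match (R : Reflection hi X X') (S : Reflection hi Y Y') (φ : X ⟶ Y) (φ' : X' ⟶ Y') : Prop :=
  ∀ j h x, S.equiv j h (app φ j x) = app φ' j (R.equiv j h x)

variable {R : Reflection hi X X'} {S : Reflection hi Y Y'} {T : Reflection hi Z Z'}

theorem Match.id : Match R R (𝟙 X) (𝟙 X') := fun _ _ _ => rfl

theorem Match.zero : Match R S 0 0 := fun j h _ => map_zero (S.equiv j h)

theorem Match.comp {φ : X ⟶ Y} {ψ : Y ⟶ Z} {φ' : X' ⟶ Y'} {ψ' : Y' ⟶ Z'}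
    (h : Match R S φ φ') (h' : Match S T ψ ψ') : Match R T (φ ≫ ψ) (φ' ≫ ψ') := fun j hj x => by
  rw [app_comp, h' j hj, h j hj, app_comp]

theorem Match.add {φ ψ : X ⟶ Y} {φ' ψ' : X' ⟶ Y'}
    (h : Match R S φ φ') (h' : Match R S ψ ψ') : Match R S (φ + ψ) (φ' + ψ') := fun j hj x => by
  rw [app_add, map_add, h' j hj, h j hj, app_add]

theorem Match.smul {φ : X ⟶ Y} {φ' : X' ⟶ Y'} (c : k)
    (h : Match R S φ φ') : Match R S (c • φ) (c • φ') := fun j hj x => by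
  rw [app_smul, map_smul, h j hj, app_smul]

theorem Match.app_outMap {φ : X ⟶ Y} {φ' : X' ⟶ Y'} (h : Match R S φ φ') (x : X'.sp i)
    (α : {α : A // Q.t α = i}) : app φ _ (R.outMap x α) = S.outMap (app φ' i x) α := by
  apply (S.equiv _ (hi α)).injective
  rw [h, equiv_outMap, equiv_outMap, app_mapOf]

theorem Match.eq_left (hR : R.IsMinus) {φ ψ : X ⟶ Y} {φ' : X' ⟶ Y'}
    (h : Match R S φ φ') (h' : Match R S ψ φ') : φ = ψ := by
  have off (j : V) (hj : j ≠ i) (x : X.sp j) : app φ j x = app ψ j x :=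
    (S.equiv j hj).injective (by rw [h, h'])
  refine hom_ext fun j x => ?_
  by_cases hj : j = i
  · subst hj
    obtain ⟨y, rfl⟩ := hR x
    rw [app_inMap, app_inMap]
    exact congrArg _ (funext fun α => off _ (hi α) _)
  · exact off j hj x

theorem Match.eq_right (hS : S.IsPlus) {φ : X ⟶ Y} {φ' ψ' : X' ⟶ Y'}
    (h : Match R S φ φ') (h' : Match R S φ ψ') : φ' = ψ' := by
  refine hom_ext fun j x => ?_
  by_cases hj : j = i
  · subst hj
    exact hS (funext fun α => by rw [← h.app_outMap, ← h'.app_outMap])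
  · obtain ⟨x, rfl⟩ := (R.equiv j hj).surjective x
    rw [← h, ← h']

theorem mapOf_equiv (R : Reflection hi X X') {α : A} {j l : V} (hs : Q.s α = j)
    (ht : Q.t α = l) (hs' : (Q.reflect i).s α = j) (ht' : (Q.reflect i).t α = l) (hj : j ≠ i)
    (hl : l ≠ i) (x : X.sp j) :
    X'.mapOf α hs' ht' (R.equiv j hj x) = R.equiv l hl (X.mapOf α hs ht x) := by
  subst hs ht
  exact R.map_equiv α hl x

theorem exists_match_right (R : Reflection hi X X') (S : Reflection hi Y Y') (φ : X ⟶ Y) :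
    ∃ φ' : X' ⟶ Y', Match R S φ φ' := by
  obtain ⟨g, hg⟩ := exists_comp_eq_of_range_le S.outMap
    ((LinearMap.pi fun α => app φ _ ∘ₗ LinearMap.proj α) ∘ₗ R.outMap) (by
      rintro _ ⟨x, rfl⟩
      refine (S.exact _).1 ((app_inMap φ (R.outMap x)).symm.trans ?_)
      rw [R.exact.apply_apply_eq_zero, map_zero])
  have hg' (x : X'.sp i) (α : {α : A // Q.t α = i}) :
      S.outMap (g x) α = app φ _ (R.outMap x α) :=
    congrFun (LinearMap.congr_fun hg x) α
  obtain ⟨φ', -, hφ'⟩ := exists_hom_of_isSource hi.isSource_reflect g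
    (fun j hj => (S.equiv j hj).toLinearMap ∘ₗ app φ j ∘ₗ (R.equiv j hj).symm.toLinearMap)
    (fun α j l hs ht hj hl x => by
      have h : Q.t α ≠ i := mt hi.reflect_s_eq_iff.2 (hs ▸ hj)
      obtain ⟨x, rfl⟩ := (R.equiv j hj).surjective x
      simp only [LinearMap.comp_apply, LinearEquiv.coe_coe, LinearEquiv.symm_apply_apply]
      rw [R.mapOf_equiv ((hi.reflect_s_of_ne h).symm.trans hs)
        ((hi.reflect_t_of_ne h).symm.trans ht) (hl := hl), S.mapOf_equiv,
        LinearEquiv.symm_apply_apply, app_mapOf])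
    (fun α l hs ht hl x => by
      have h : Q.t α = i := hi.reflect_s_eq_iff.1 hs
      obtain rfl : Q.s α = l := (reflect_t_of_t h).symm.trans ht
      rw [← R.equiv_outMap ⟨α, h⟩, ← S.equiv_outMap ⟨α, h⟩, hg']
      simp only [LinearMap.comp_apply, LinearEquiv.coe_coe, LinearEquiv.symm_apply_apply])
  refine ⟨φ', fun j hj x => ?_⟩
  simp only [hφ' j hj, LinearMap.comp_apply, LinearEquiv.coe_coe, LinearEquiv.symm_apply_apply]

theorem exists_match_left (R : Reflection hi X X') (S : Reflection hi Y Y') (φ' : X' ⟶ Y') :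
    ∃ φ : X ⟶ Y, Match R S φ φ' := by
  classical
  let f (j : V) (hj : j ≠ i) : X.sp j →ₗ[k] Y.sp j :=
    (S.equiv j hj).symm.toLinearMap ∘ₗ app φ' j ∘ₗ (R.equiv j hj).toLinearMap
  have hf (j : V) (hj : j ≠ i) (x : X.sp j) :
      S.equiv j hj (f j hj x) = app φ' j (R.equiv j hj x) :=
    (S.equiv j hj).apply_symm_apply _
  obtain ⟨g, hg⟩ := exists_comp_eq_of_ker_le (X.inMap i)
    (Y.inMap i ∘ₗ LinearMap.pi fun α => f _ (hi α) ∘ₗ LinearMap.proj α) fun y hy => by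
      obtain ⟨x, rfl⟩ := (R.exact y).1 hy
      refine (S.exact _).2 ⟨app φ' i x, funext fun α => (S.equiv _ (hi α)).injective ?_⟩
      rw [LinearMap.pi_apply, LinearMap.comp_apply, LinearMap.proj_apply, hf, R.equiv_outMap,
        S.equiv_outMap, app_mapOf]
  obtain ⟨φ, -, hφ⟩ := exists_hom_of_isSink hi g f
    (fun α h x => by
      apply (S.equiv _ h).injective
      rw [hf, ← R.map_equiv, app_mapOf, ← hf, ← S.map_equiv])
    (fun α h x => by
      rw [← inMap_single X ⟨α, h⟩, ← LinearMap.comp_apply, hg, LinearMap.comp_apply,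
        ← inMap_single Y ⟨α, h⟩]
      refine congrArg _ (funext fun β => ?_)
      exact Pi.apply_single (fun β : {α : A // Q.t α = i} => f _ (hi β))
        (fun β => map_zero (f _ (hi β))) ⟨α, h⟩ x β)
  exact ⟨φ, fun j hj x => by rw [hφ j hj, hf]⟩

/-- The adjunction `Hom(S_i^- X', Y) ≃ Hom(X', S_i^+ Y)`. -/
def homEquiv (hR : R.IsMinus) (hS : S.IsPlus) : (X ⟶ Y) ≃ₗ[k] (X' ⟶ Y') :=
  LinearEquiv.ofBijective
    { toFun φ := (R.exists_match_right S φ).choose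
      map_add' φ ψ := Match.eq_right hS (R.exists_match_right S _).choose_spec
        ((R.exists_match_right S φ).choose_spec.add (R.exists_match_right S ψ).choose_spec)
      map_smul' c φ := Match.eq_right hS (R.exists_match_right S _).choose_spec
        ((R.exists_match_right S φ).choose_spec.smul c) }
    ⟨fun φ ψ h => Match.eq_left hR (R.exists_match_right S φ).choose_spec
        ((congrArg (Match R S ψ) h).mpr (R.exists_match_right S ψ).choose_spec),
      fun φ' => (R.exists_match_left S φ').imp fun φ h =>
        Match.eq_right hS (R.exists_match_right S φ).choose_spec h⟩

theorem Match.isSplitMono (hR : R.IsMinus) {φ : X ⟶ Y} {φ' : X' ⟶ Y'} (h : Match R S φ φ')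
    (hφ' : IsSplitMono φ') : IsSplitMono φ := by
  obtain ⟨ρ, hρ⟩ := S.exists_match_left R (retraction φ')
  refine ⟨⟨ρ, Match.eq_left hR (h.comp hρ) ?_⟩⟩
  rw [IsSplitMono.id]
  exact Match.id

theorem Match.isSplitEpi (hS : S.IsMinus) {φ : X ⟶ Y} {φ' : X' ⟶ Y'} (h : Match R S φ φ')
    (hφ' : IsSplitEpi φ') : IsSplitEpi φ := by
  obtain ⟨σ, hσ⟩ := S.exists_match_left R (section_ φ')
  refine ⟨⟨σ, Match.eq_left hS (hσ.comp h) ?_⟩⟩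
  rw [IsSplitEpi.id]
  exact Match.id

theorem IsMinus.nonempty_iso (hR : R.IsMinus) (hS : S.IsMinus) (θ : X' ≅ Y') :
    Nonempty (X ≅ Y) := by
  obtain ⟨φ, hφ⟩ := R.exists_match_left S θ.hom
  obtain ⟨ψ, hψ⟩ := S.exists_match_left R θ.inv
  refine ⟨⟨φ, ψ, Match.eq_left hR (hφ.comp hψ) ?_, Match.eq_left hS (hψ.comp hφ) ?_⟩⟩
  · rw [θ.hom_inv_id]
    exact Match.id
  · rw [θ.inv_hom_id]
    exact Match.id

theorem IsPlus.nonempty_iso (hR : R.IsPlus) (hS : S.IsPlus) (θ : X ≅ Y) :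
    Nonempty (X' ≅ Y') := by
  obtain ⟨φ, hφ⟩ := R.exists_match_right S θ.hom
  obtain ⟨ψ, hψ⟩ := S.exists_match_right R θ.inv
  refine ⟨⟨φ, ψ, Match.eq_right hR (hφ.comp hψ) ?_, Match.eq_right hS (hψ.comp hφ) ?_⟩⟩
  · rw [θ.hom_inv_id]
    exact Match.id
  · rw [θ.inv_hom_id]
    exact Match.id

/-- A reflection of `X` is one of any representation isomorphic to `X`. -/
def ofIso (R : Reflection hi X X') (θ : X ≅ Y) : Reflection hi Y X' where
  equiv j hj := (isoApp θ j).symm.trans (R.equiv j hj)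
  map_equiv α h x := by
    obtain ⟨x, rfl⟩ := (isoApp θ _).surjective x
    rw [LinearEquiv.trans_apply, LinearEquiv.symm_apply_apply, R.map_equiv α h]
    exact congrArg (R.equiv _ h) ((LinearEquiv.eq_symm_apply _).2 (app_mapOf θ.hom α rfl rfl x))
  outMap := (LinearMap.pi fun α => app θ.hom _ ∘ₗ LinearMap.proj α) ∘ₗ R.outMap
  equiv_outMap α x := (congrArg (R.equiv _ (hi α))
    ((isoApp θ _).symm_apply_apply (R.outMap x α))).trans (R.equiv_outMap α x)
  exact y := by
    obtain ⟨y, rfl⟩ : ∃ z, (fun α => isoApp θ _ (z α)) = y :=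
      ⟨fun α => (isoApp θ _).symm (y α), funext fun α => (isoApp θ _).apply_symm_apply (y α)⟩
    simp only [isoApp_apply]
    rw [← app_inMap, ← isoApp_apply, LinearEquiv.map_eq_zero_iff, R.exact]
    refine exists_congr fun x => ⟨fun h => ?_, fun h => funext fun α => ?_⟩
    · rw [← h]
      rfl
    · exact (isoApp θ _).injective (congrFun h α)

theorem IsPlus.ofIso (h : R.IsPlus) (θ : X ≅ Y) : (R.ofIso θ).IsPlus := fun _ _ hxy =>
  h (funext fun α => (isoApp θ _).injective (congrFun hxy α))

theorem IsMinus.ofIso (h : R.IsMinus) (θ : X ≅ Y) : (R.ofIso θ).IsMinus := by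
  intro y
  obtain ⟨x, hx⟩ := h ((isoApp θ i).symm y)
  refine ⟨fun α => app θ.hom _ (x α), ?_⟩
  rw [← app_inMap, hx]
  exact (isoApp θ i).apply_symm_apply y

theorem IsMinus.finDim (hR : R.IsMinus) (hX : X'.FinDim) : X.FinDim := by
  have off (j : V) (hj : j ≠ i) : Module.Finite k (X.sp j) := by
    have := hX j
    exact Module.Finite.equiv (R.equiv j hj).symm
  intro j
  by_cases hj : j = i
  · subst hj
    have (α : {α : A // Q.t α = j}) : Module.Finite k (X.sp (Q.s α)) := off _ (hi α)
    exact Module.Finite.of_surjective _ hR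
  · exact off j hj

theorem IsPlus.isZeroRep (hR : R.IsPlus) (hX : ∀ j, j ≠ i → Subsingleton (X.sp j)) :
    X'.IsZeroRep := by
  intro j
  by_cases hj : j = i
  · subst hj
    have (α : {α : A // Q.t α = j}) : Subsingleton (X.sp (Q.s α)) := hX _ (hi α)
    exact hR.subsingleton
  · have := hX j hj
    exact (R.equiv j hj).symm.injective.subsingleton

theorem IsMinus.isZeroRep (hR : R.IsMinus) (hX : ∀ j, j ≠ i → Subsingleton (X'.sp j)) :
    X.IsZeroRep := by
  have off (j : V) (hj : j ≠ i) : Subsingleton (X.sp j) := by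
    have := hX j hj
    exact (R.equiv j hj).injective.subsingleton
  intro j
  by_cases hj : j = i
  · subst hj
    have (α : {α : A // Q.t α = j}) : Subsingleton (X.sp (Q.s α)) := off _ (hi α)
    exact hR.subsingleton
  · exact off j hj

end Reflection

end Reflection

/-! ### The reflections `S_i^+` and `S_i^-` -/

section ReflPlus

variable {V A : Type} [DecidableEq V] [Fintype A] {Q : FinQuiver V A} {i : V} {k : Type u}
  [Field k] (X : QRep Q k) (hi : Q.IsSink i)

/-- The identification of `X` and `S_i^+ X` off `i`. -/
def plusOff {j : V} (hj : j ≠ i) : X.sp j ≃ₗ[k] (X.reflPlus hi).sp j :=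
  (X.newSpOff i _ hj).symm

/-- The identification of the space of `S_i^+ X` at `i` with the kernel defining it. -/
def plusAt {j : V} (hj : j = i) : (X.reflPlus hi).sp j ≃ₗ[k] LinearMap.ker (X.inMap i) :=
  X.newSpAt i (ModuleCat.of k (LinearMap.ker (X.inMap i))) hj

theorem reflPlus_mapOf_off {α : A} (h : Q.t α ≠ i) {j l : V} (hs : Q.s α = j) (ht : Q.t α = l)
    (hs' : (Q.reflect i).s α = j) (ht' : (Q.reflect i).t α = l) (hj : j ≠ i) (hl : l ≠ i)
    (x : X.sp j) : (X.reflPlus hi).mapOf α hs' ht' (X.plusOff hi hj x) =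
      X.plusOff hi hl (X.mapOf α hs ht x) := by
  obtain ⟨y, rfl⟩ := (X.plusOff hi hj).symm.surjective x
  rw [LinearEquiv.apply_symm_apply]
  subst hs' ht'
  rw [mapOf_rfl]
  simp only [reflPlus]
  rw [dif_neg h]
  rfl

theorem reflPlus_mapOf_at {α : A} (h : Q.t α = i) {j l : V} (hs : Q.s α = l)
    (hs' : (Q.reflect i).s α = j) (ht' : (Q.reflect i).t α = l) (hj : j = i) (hl : l ≠ i)
    (y : (X.reflPlus hi).sp j) : (X.reflPlus hi).mapOf α hs' ht' y =
      X.plusOff hi hl (X.spCast hs ((X.plusAt hi hj y).1 ⟨α, h⟩)) := by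
  subst hs' ht'
  rw [mapOf_rfl]
  simp only [reflPlus]
  rw [dif_pos h]
  rfl

/-- The reflection between `X` and `S_i^+ X`. -/
def reflPlusReflection : Reflection hi X (X.reflPlus hi) where
  equiv _ hj := X.plusOff hi hj
  map_equiv α h x := X.reflPlus_mapOf_off hi h rfl rfl _ _ (hi α) h x
  outMap := (LinearMap.ker (X.inMap i)).subtype ∘ₗ (X.plusAt hi rfl).toLinearMap
  equiv_outMap α x := (X.reflPlus_mapOf_at hi α.2 rfl _ _ rfl (hi α) x).symm
  exact y := ⟨fun hy => ⟨(X.plusAt hi rfl).symm ⟨y, hy⟩,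
      congrArg Subtype.val ((X.plusAt hi rfl).apply_symm_apply ⟨y, hy⟩)⟩,
    fun ⟨x, hx⟩ => hx ▸ (X.plusAt hi rfl x).2⟩

theorem isPlus_reflPlusReflection : (X.reflPlusReflection hi).IsPlus :=
  Subtype.val_injective.comp (X.plusAt hi rfl).injective

end ReflPlus

section MapOf

variable {V A : Type} {Q : FinQuiver V A} {k : Type u} [Field k] (X : QRep Q k) {α : A} {j l : V}

theorem ofEq_mapOf {Q' : FinQuiver V A} (h : Q = Q') (hs : Q'.s α = j) (ht : Q'.t α = l) :
    (X.ofEq h).mapOf α hs ht = X.mapOf α ((congrArg (fun q => q.s α) h).trans hs)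
      ((congrArg (fun q => q.t α) h).trans ht) := by
  subst h hs ht
  rfl

theorem mapOf_eq_spCast (hs : Q.s α = j) (ht : Q.t α = l) (x : X.sp j) :
    X.mapOf α hs rfl x = X.spCast ht.symm (X.mapOf α hs ht x) := by
  subst ht
  rfl

end MapOf

section Source

variable {V A : Type} {Q : FinQuiver V A} {i : V} {k : Type u} [Field k] {X : QRep Q k}

theorem IsBrick.subsingleton_of_mapOf_eq_zero (hX : X.IsBrick) (hi : Q.IsSource i) {x : X.sp i}
    (hx : x ≠ 0) (hxα : ∀ α {l} (hs : Q.s α = i) (ht : Q.t α = l), X.mapOf α hs ht x = 0)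
    {j : V} (hj : j ≠ i) : Subsingleton (X.sp j) := by
  obtain ⟨f, hf⟩ : ∃ f : Module.Dual k (X.sp i), f x ≠ 0 :=
    not_forall.1 (mt (Module.forall_dual_apply_eq_zero_iff k x).1 hx)
  obtain ⟨φ, hφi, hφ⟩ := exists_hom_of_isSource hi (f.smulRight x)
    (fun j _ => (0 : X.sp j →ₗ[k] X.sp j))
    (fun α j l hs ht _ _ y => by simp only [LinearMap.zero_apply, map_zero])
    (fun α l hs ht _ y => by
      rw [LinearMap.zero_apply, LinearMap.smulRight_apply, map_smul, hxα α hs ht, smul_zero])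
  obtain ⟨c, rfl⟩ := hX.exists_eq_smul_id φ
  have hc : c ≠ 0 := by
    rintro rfl
    have hx0 := LinearMap.congr_fun hφi x
    rw [zero_smul, app_zero, LinearMap.smulRight_apply] at hx0
    exact smul_ne_zero hf hx hx0.symm
  refine subsingleton_of_forall_eq 0 fun y => ?_
  have hy := LinearMap.congr_fun (hφ j hj) y
  rw [app_smul, app_id, LinearMap.zero_apply] at hy
  exact (smul_eq_zero.1 hy).resolve_left hc

end Source

section Minus

variable {V A : Type} [DecidableEq V] [DecidableEq A] {Q : FinQuiver V A} {i : V} {k : Type u}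
  [Field k] (hi : Q.IsSink i) (X' : QRep (Q.reflect i) k)

/-- `S_i^- X'` as a representation of `Q`, for a representation `X'` of `σ_i Q`. -/
def minus : QRep Q k :=
  (X'.reflMinus hi.isSource_reflect).ofEq (Q.reflect_reflect i)

/-- The identification of `S_i^- X'` and `X'` off `i`. -/
def minusOff {j : V} (hj : j ≠ i) : (minus hi X').sp j ≃ₗ[k] X'.sp j :=
  X'.newSpOff i _ hj

/-- The identification of the space of `S_i^- X'` at `i` with the cokernel defining it. -/
def minusAt {j : V} (hj : j = i) : (minus hi X').sp j ≃ₗ[k]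
    (∀ α : {α : A // (Q.reflect i).s α = i}, X'.sp ((Q.reflect i).t α)) ⧸
      LinearMap.range (X'.outMap i) :=
  X'.newSpAt i (ModuleCat.of k ((∀ α : {α : A // (Q.reflect i).s α = i},
    X'.sp ((Q.reflect i).t α)) ⧸ LinearMap.range (X'.outMap i))) hj

theorem isZeroRep_minus (hX' : X'.IsZeroRep) : (minus hi X').IsZeroRep := fun j => by
  by_cases hj : j = i
  · have (α : {α : A // (Q.reflect i).s α = i}) : Subsingleton (X'.sp ((Q.reflect i).t α)) :=
      hX' _
    exact (minusAt hi X' hj).toEquiv.subsingleton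
  · exact (minusOff hi X' hj).toEquiv.subsingleton_congr.2 (hX' j)

theorem minus_mapOf {α : A} {j l : V} (hs : Q.s α = j) (ht : Q.t α = l)
    (hs' : ((Q.reflect i).reflect i).s α = j) (ht' : ((Q.reflect i).reflect i).t α = l) :
    (minus hi X').mapOf α hs ht = (X'.reflMinus hi.isSource_reflect).mapOf α hs' ht' :=
  ofEq_mapOf (X'.reflMinus hi.isSource_reflect) (Q.reflect_reflect i) hs ht

theorem minus_mapOf_off {α : A} (h : Q.t α ≠ i) {j l : V} (hs : Q.s α = j) (ht : Q.t α = l)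
    (hs' : (Q.reflect i).s α = j) (ht' : (Q.reflect i).t α = l) (hj : j ≠ i) (hl : l ≠ i)
    (x : (minus hi X').sp j) :
    (minus hi X').mapOf α hs ht x =
      (minusOff hi X' hl).symm (X'.mapOf α hs' ht' (minusOff hi X' hj x)) := by
  have hs2 : ((Q.reflect i).reflect i).s α = j := by rw [reflect_reflect, hs]
  have ht2 : ((Q.reflect i).reflect i).t α = l := by rw [reflect_reflect, ht]
  rw [minus_mapOf hi X' hs ht hs2 ht2]
  subst hs2 ht2
  rw [mapOf_rfl]
  simp only [reflMinus]
  rw [dif_neg (mt hi.reflect_s_eq_iff.1 h)]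
  rfl

theorem minus_mapOf_at {α : A} (h : (Q.reflect i).s α = i) {j l : V} (hs : Q.s α = j)
    (ht : Q.t α = l) (hs' : j = (Q.reflect i).t α) (hj : j ≠ i) (hl : l = i)
    (x : (minus hi X').sp j) :
    (minus hi X').mapOf α hs ht x = (minusAt hi X' hl).symm
      ((LinearMap.range (X'.outMap i)).mkQ
        (Pi.single (M := fun β : {α : A // (Q.reflect i).s α = i} => X'.sp ((Q.reflect i).t β))
          ⟨α, h⟩ (X'.spCast hs' (minusOff hi X' hj x)))) := by
  have hs2 : ((Q.reflect i).reflect i).s α = j := by rw [reflect_reflect, hs]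
  have ht2 : ((Q.reflect i).reflect i).t α = l := by rw [reflect_reflect, ht]
  rw [minus_mapOf hi X' hs ht hs2 ht2]
  subst hs2 ht2
  rw [mapOf_rfl]
  simp only [reflMinus]
  rw [dif_pos h]
  rfl

/-- The identification of the two direct sums over the arrows at `i`. -/
def minusSum : (∀ α : {α : A // Q.t α = i}, (minus hi X').sp (Q.s α)) ≃ₗ[k]
    (∀ β : {α : A // (Q.reflect i).s α = i}, X'.sp ((Q.reflect i).t β)) where
  toFun y β := X'.spCast (reflect_t_of_t (hi.reflect_s_eq_iff.1 β.2)).symm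
    (minusOff hi X' (hi β) (y ⟨β, hi.reflect_s_eq_iff.1 β.2⟩))
  map_add' y z := funext fun β => by simp only [Pi.add_apply, map_add]
  map_smul' c y := funext fun β => by simp only [Pi.smul_apply, map_smul, RingHom.id_apply]
  invFun y α := (minusOff hi X' (hi α)).symm
    ((X'.spCast (reflect_t_of_t α.2).symm).symm (y ⟨α, reflect_s_of_t α.2⟩))
  left_inv y := funext fun α => by simp only [LinearEquiv.symm_apply_apply]
  right_inv y := funext fun β => by simp only [LinearEquiv.apply_symm_apply]

theorem minusSum_apply (y : ∀ α : {α : A // Q.t α = i}, (minus hi X').sp (Q.s α))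
    (β : {α : A // (Q.reflect i).s α = i}) :
    minusSum hi X' y β = X'.spCast (reflect_t_of_t (hi.reflect_s_eq_iff.1 β.2)).symm
      (minusOff hi X' (hi β) (y ⟨β, hi.reflect_s_eq_iff.1 β.2⟩)) := rfl

theorem minus_inMap [Fintype A] (y : ∀ α : {α : A // Q.t α = i}, (minus hi X').sp (Q.s α)) :
    (minus hi X').inMap i y = (minusAt hi X' rfl).symm
      ((LinearMap.range (X'.outMap i)).mkQ (minusSum hi X' y)) := by
  suffices h : (minus hi X').inMap i = (minusAt hi X' rfl).symm.toLinearMap ∘ₗ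
      (LinearMap.range (X'.outMap i)).mkQ ∘ₗ (minusSum hi X').toLinearMap from
    LinearMap.congr_fun h y
  refine LinearMap.pi_ext fun α x => ?_
  rw [inMap_single, minus_mapOf_at hi X' (reflect_s_of_t α.2) rfl α.2
    (reflect_t_of_t α.2).symm (hi α) rfl]
  refine congrArg _ (congrArg _ (funext fun β => ?_))
  rw [LinearEquiv.coe_coe, minusSum_apply]
  by_cases hβ : β = ⟨α, reflect_s_of_t α.2⟩
  · subst hβ
    rw [Pi.single_eq_same, Pi.single_eq_same]
  · have hβ' : (⟨β, hi.reflect_s_eq_iff.1 β.2⟩ : {α : A // Q.t α = i}) ≠ α := fun h =>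
      hβ (by subst h; rfl)
    rw [Pi.single_eq_of_ne hβ, Pi.single_eq_of_ne hβ', map_zero, map_zero]

/-- The reflection between `S_i^- X'` and `X'`. -/
def minusReflection [Fintype A] : Reflection hi (minus hi X') X' where
  equiv _ hj := minusOff hi X' hj
  map_equiv α h x := by
    rw [← mapOf_rfl, minus_mapOf_off hi X' h rfl rfl (hi.reflect_s_of_ne h)
      (hi.reflect_t_of_ne h) (hi α) h, LinearEquiv.apply_symm_apply]
  outMap := LinearMap.pi fun α => (minusOff hi X' (hi α)).symm.toLinearMap ∘ₗ
    X'.mapOf α.1 (reflect_s_of_t α.2) (reflect_t_of_t α.2)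
  equiv_outMap α x := (minusOff hi X' (hi α)).apply_symm_apply _
  exact y := by
    rw [minus_inMap, LinearEquiv.map_eq_zero_iff, Submodule.mkQ_apply,
      Submodule.Quotient.mk_eq_zero, LinearMap.mem_range]
    refine exists_congr fun x => ?_
    rw [← (minusSum hi X').injective.eq_iff]
    refine Eq.congr_left (funext fun β => ?_)
    rw [minusSum_apply, LinearMap.pi_apply, LinearMap.comp_apply, LinearEquiv.coe_coe,
      LinearEquiv.apply_symm_apply]
    exact X'.mapOf_eq_spCast β.2 _ x

theorem isMinus_minusReflection [Fintype A] : (minusReflection hi X').IsMinus := by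
  intro x
  obtain ⟨y, hy⟩ := Submodule.mkQ_surjective _ (minusAt hi X' rfl x)
  obtain ⟨z, rfl⟩ := (minusSum hi X').surjective y
  exact ⟨z, by rw [minus_inMap, hy, LinearEquiv.symm_apply_apply]⟩

end Minus

end QRep

/-! ### Sequences of sinks -/

namespace FinQuiver

variable {V A : Type} {Q : FinQuiver V A}

/-- Some arrow joins `i` and `j`. -/
def Adj (Q : FinQuiver V A) (i j : V) : Prop :=
  ∃ α, (Q.s α = i ∧ Q.t α = j) ∨ (Q.s α = j ∧ Q.t α = i)

/-- `v b` is adjacent to `v a`, and `b` is its first occurrence after `a`. For a sequence of sinks,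
these `b` index the immediate successors of the `a`-th representation in the Auslander–Reiten
quiver. -/
def Follows (Q : FinQuiver V A) (v : ℕ → V) (a b : ℕ) : Prop :=
  a < b ∧ (∀ c, a < c → c < b → v c ≠ v b) ∧ Q.Adj (v a) (v b)

theorem Follows.exists_arrow {v : ℕ → V} {b : ℕ} (hab : Q.Follows v 0 b) (hi : Q.IsSink (v 0)) :
    ∃ α, Q.s α = v b ∧ Q.t α = v 0 :=
  hab.2.2.imp fun α hα => hα.resolve_left fun h => hi α h.1

theorem Follows.forall_ne {v : ℕ → V} {b : ℕ} (hab : Q.Follows v 0 b) (hi : Q.IsSink (v 0)) :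
    ∀ c < b, v c ≠ v b := fun c hc => by
  rcases Nat.eq_zero_or_pos c with rfl | hc'
  · obtain ⟨α, hs, -⟩ := hab.exists_arrow hi
    exact (hs.symm.trans_ne (hi α)).symm
  · exact hab.2.1 c hc' hc

variable [DecidableEq V]

theorem adj_reflect {i j l : V} : (Q.reflect i).Adj j l ↔ Q.Adj j l := by
  refine exists_congr fun α => ?_
  simp only [reflect]
  split_ifs <;> tauto

theorem IsHeight.reflect {h : V → ℤ} (hh : Q.IsHeight h) {i : V} (hi : Q.IsSink i) :
    (Q.reflect i).IsHeight (Function.update h i (h i + 2)) := fun α => by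
  by_cases hα : Q.t α = i
  · rw [reflect_s_of_t hα, reflect_t_of_t hα, Function.update_self,
      Function.update_of_ne (hi α), hh α, hα]
    ring
  · rw [hi.reflect_s_of_ne hα, hi.reflect_t_of_ne hα, Function.update_of_ne hα,
      Function.update_of_ne (hi α), hh α]

theorem IsSimple.reflect (hsimple : Q.IsSimple) {i : V} (hi : Q.IsSink i) :
    (Q.reflect i).IsSimple := fun α β hs ht => by
  have hiff : Q.t α = i ↔ Q.t β = i := by
    rw [← hi.reflect_s_eq_iff, ← hi.reflect_s_eq_iff, hs]
  by_cases hα : Q.t α = i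
  · have hβ := hiff.1 hα
    rw [reflect_t_of_t hα, reflect_t_of_t hβ] at ht
    exact hsimple ht (hα.trans hβ.symm)
  · have hβ := mt hiff.2 hα
    rw [hi.reflect_t_of_ne hα, hi.reflect_t_of_ne hβ] at ht
    rw [hi.reflect_s_of_ne hα, hi.reflect_s_of_ne hβ] at hs
    exact hsimple hs ht

theorem follows_succ {v : ℕ → V} {a b : ℕ} :
    Q.Follows v (a + 1) (b + 1) ↔ (Q.reflect (v 0)).Follows (fun n => v (n + 1)) a b := by
  rw [Follows, Follows, adj_reflect, Nat.add_lt_add_iff_right]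
  refine and_congr_right fun _ => and_congr_left fun _ =>
    ⟨fun h c hc hc' => h (c + 1) (by omega) (by omega), fun h c hc hc' => ?_⟩
  obtain ⟨c, rfl⟩ := Nat.exists_eq_succ_of_ne_zero (Nat.ne_zero_of_lt hc)
  exact h c (by omega) (by omega)

/-- A quiver with height `h` and without multiple arrows, together with an infinite sequence of
vertices which are successively sinks and in which every vertex occurs infinitely often. -/
structure SinkOrder (Q : FinQuiver V A) (h : V → ℤ) (v : ℕ → V) : Prop where
  isHeight : Q.IsHeight h
  isSimple : Q.IsSimple
  sinks : ∀ n, Q.SinkSequence ((List.range n).map v)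
  often : ∀ j n, ∃ m, n ≤ m ∧ v m = j

theorem SinkOrder.isSink {h : V → ℤ} {v : ℕ → V} (H : SinkOrder Q h v) : Q.IsSink (v 0) :=
  (H.sinks 1).1

theorem SinkOrder.succ {h : V → ℤ} {v : ℕ → V} (H : SinkOrder Q h v) :
    SinkOrder (Q.reflect (v 0)) (Function.update h (v 0) (h (v 0) + 2)) fun n => v (n + 1) where
  isHeight := H.isHeight.reflect H.isSink
  isSimple := H.isSimple.reflect H.isSink
  sinks n := by
    have := H.sinks (n + 1)
    rw [List.range_succ_eq_map, List.map_cons, List.map_map] at this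
    exact this.2
  often j n := by
    obtain ⟨m, hm, rfl⟩ := H.often j (n + 1)
    exact ⟨m - 1, by omega, by rw [Nat.sub_add_cancel (by omega)]⟩

theorem SinkOrder.exists_follows_zero {h : V → ℤ} {v : ℕ → V} (H : SinkOrder Q h v)
    {α : A} (hα : Q.t α = v 0) : ∃ b, v b = Q.s α ∧ Q.Follows v 0 b ∧ ∀ c < b, v c ≠ v b := by
  classical
  have hex : ∃ b, v b = Q.s α := (H.often (Q.s α) 0).imp fun _ hb => hb.2
  have hv := Nat.find_spec hex
  have hmin : ∀ c < Nat.find hex, v c ≠ v (Nat.find hex) := fun c hc hc' =>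
    Nat.find_min hex hc (hc'.trans hv)
  refine ⟨Nat.find hex, hv, ⟨Nat.pos_of_ne_zero fun h0 => H.isSink α ?_, fun c _ => hmin c,
    α, .inr ⟨hv.symm, hα⟩⟩, hmin⟩
  rw [← hv, h0]

/-- The height of `v a` in the quiver obtained by reflecting at `v 0, …, v (a - 1)`: each
reflection at `v a` raises it by `2`. -/
def level (h : V → ℤ) (v : ℕ → V) (a : ℕ) : ℤ :=
  h (v a) + 2 * Nat.count (fun c => v c = v a) a

theorem level_succ (h : V → ℤ) (v : ℕ → V) (a : ℕ) :
    level h v (a + 1) =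
      level (Function.update h (v 0) (h (v 0) + 2)) (fun n => v (n + 1)) a := by
  rw [level, level, Nat.count_succ']
  by_cases h0 : v 0 = v (a + 1)
  · rw [if_pos h0, ← h0, Function.update_self]
    push_cast
    ring
  · rw [if_neg h0, Function.update_of_ne (Ne.symm h0), add_zero]

theorem level_eq_of_forall_ne (h : V → ℤ) {v : ℕ → V} {b : ℕ} (hb : ∀ c < b, v c ≠ v b) :
    level h v b = h (v b) := by
  rw [level, Nat.count_of_forall_not fun c hc => hb c hc, Nat.cast_zero, mul_zero, add_zero]

theorem SinkOrder.level_of_follows {h : V → ℤ} {v : ℕ → V} (H : SinkOrder Q h v) {a b : ℕ}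
    (hab : Q.Follows v a b) : level h v b = level h v a + 1 := by
  induction a generalizing Q h v b with
  | zero =>
    obtain ⟨α, hs, ht⟩ := hab.exists_arrow H.isSink
    rw [level_eq_of_forall_ne h (hab.forall_ne H.isSink), level_eq_of_forall_ne h (by simp), ← hs,
      H.isHeight α, ht]
  | succ a ih =>
    obtain ⟨b, rfl⟩ := Nat.exists_eq_succ_of_ne_zero (Nat.ne_zero_of_lt hab.1)
    rw [level_succ, level_succ, ih H.succ (follows_succ.1 hab)]

end FinQuiver

/-! ### Preprojective representations -/

namespace QRep

open FinQuiver

variable {V A : Type} [DecidableEq V] [Fintype A] {k : Type u} [Field k]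

/-- `X ≅ S⁻_{v 0} ⋯ S⁻_{v (a - 1)} S(v a)`, where no reflection is degenerate: each step is both a
reflection `S⁺` and a reflection `S⁻`. -/
def IsPreprojective : ℕ → (Q : FinQuiver V A) → (ℕ → V) → QRep Q k → Prop
  | 0, Q, v, X => Q.IsSink (v 0) ∧ X.IsSimpleAt (v 0)
  | a + 1, Q, v, X => ∃ (hi : Q.IsSink (v 0)) (X' : QRep (Q.reflect (v 0)) k)
      (R : Reflection hi X X'), R.IsPlus ∧ R.IsMinus ∧
        IsPreprojective a (Q.reflect (v 0)) (fun n => v (n + 1)) X'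

namespace IsPreprojective

variable {Q : FinQuiver V A} {v : ℕ → V} {a b : ℕ} {X Y : QRep Q k}

theorem of_iso (hX : IsPreprojective a Q v X) (θ : X ≅ Y) : IsPreprojective a Q v Y := by
  cases a with
  | zero => exact ⟨hX.1, hX.2.of_iso θ⟩
  | succ a =>
    obtain ⟨hi, X', R, hp, hm, hX'⟩ := hX
    exact ⟨hi, X', R.ofIso θ, hp.ofIso θ, hm.ofIso θ, hX'⟩

theorem finDim (hX : IsPreprojective a Q v X) : X.FinDim := by
  induction a generalizing Q v with
  | zero => exact hX.2.finDim
  | succ a ih =>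
    obtain ⟨_, _, _, _, hm, hX'⟩ := hX
    exact hm.finDim (ih hX')

theorem isBrick (hX : IsPreprojective a Q v X) : X.IsBrick := by
  induction a generalizing Q v with
  | zero => exact hX.2.isBrick hX.1
  | succ a ih =>
    obtain ⟨hi, X', R, hp, hm, hX'⟩ := hX
    exact (Reflection.homEquiv hm hp).finrank_eq.trans (ih hX')

theorem isIndec (hX : IsPreprojective a Q v X) : X.IsIndec :=
  hX.isBrick.isIndec hX.finDim

theorem hom_eq_zero (hX : IsPreprojective a Q v X) (hY : IsPreprojective b Q v Y)
    (hab : b < a) (φ : X ⟶ Y) : φ = 0 := by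
  induction b generalizing Q v a with
  | zero =>
    obtain ⟨a, rfl⟩ := Nat.exists_eq_succ_of_ne_zero hab.ne'
    obtain ⟨_, _, _, _, hm, _⟩ := hX
    exact hY.2.hom_eq_zero hY.1 hm φ
  | succ b ih =>
    obtain ⟨a, rfl⟩ := Nat.exists_eq_succ_of_ne_zero (Nat.ne_zero_of_lt hab)
    obtain ⟨hi, X', R, -, hm, hX'⟩ := hX
    obtain ⟨_, Y', S, -, -, hY'⟩ := hY
    obtain ⟨φ', hφ'⟩ := R.exists_match_right S φ
    obtain rfl := ih hX' hY' (by omega) φ'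
    exact hφ'.eq_left hm Reflection.Match.zero

theorem nonempty_iso (hX : IsPreprojective a Q v X) (hY : IsPreprojective a Q v Y) :
    Nonempty (X ≅ Y) := by
  induction a generalizing Q v with
  | zero => exact (hX.2.isProj hX.1).nonempty_iso (hY.2.isProj hY.1)
  | succ a ih =>
    obtain ⟨hi, X', R, -, hm, hX'⟩ := hX
    obtain ⟨_, Y', S, -, hm', hY'⟩ := hY
    obtain ⟨θ⟩ := ih hX' hY'
    exact hm.nonempty_iso hm' θ

theorem isIso_or_eq_zero (hX : IsPreprojective a Q v X) (hY : IsPreprojective a Q v Y)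
    (φ : X ⟶ Y) : IsIso φ ∨ φ = 0 := by
  obtain ⟨θ⟩ := hX.nonempty_iso hY
  obtain ⟨c, hc⟩ := hX.isBrick.exists_eq_smul_id (φ ≫ θ.inv)
  have hφ : φ = c • θ.hom := by
    rw [← Category.comp_id φ, ← θ.inv_hom_id, ← Category.assoc, ← hc,
      Linear.smul_comp, Category.id_comp]
  by_cases hc0 : c = 0
  · exact Or.inr (by rw [hφ, hc0, zero_smul])
  · refine Or.inl ⟨⟨c⁻¹ • θ.inv, ?_, ?_⟩⟩ <;> simp [hφ, smul_smul, hc0]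

theorem not_isSplitMono (hX : IsPreprojective a Q v X) (hY : IsPreprojective b Q v Y)
    (hab : a ≠ b) (φ : X ⟶ Y) : ¬ IsSplitMono φ := fun _ => by
  refine hX.isBrick.id_ne_zero ((IsSplitMono.id φ).symm.trans ?_)
  rcases hab.lt_or_gt with h | h
  · rw [hY.hom_eq_zero hX h (retraction φ), Limits.comp_zero]
  · exact (congrArg (· ≫ retraction φ) (hX.hom_eq_zero hY h φ)).trans Limits.zero_comp

theorem not_isSplitEpi (hX : IsPreprojective a Q v X) (hY : IsPreprojective b Q v Y)
    (hab : a ≠ b) (φ : X ⟶ Y) : ¬ IsSplitEpi φ := fun _ =>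
  hY.not_isSplitMono hX hab.symm (section_ φ) inferInstance

end IsPreprojective

/-! ### Degenerate reflections -/

variable {Q : FinQuiver V A} {i : V}

namespace Reflection

variable {hi : Q.IsSink i} {X : QRep Q k} {X' : QRep (Q.reflect i) k} {R : Reflection hi X X'}

theorem isPlus_or_subsingleton (R : Reflection hi X X') (hX : X'.IsBrick) :
    R.IsPlus ∨ ∀ j, j ≠ i → Subsingleton (X'.sp j) := by
  refine or_iff_not_imp_left.2 fun hR j hj => ?_
  obtain ⟨x, hx, hx0⟩ : ∃ x, R.outMap x = 0 ∧ x ≠ 0 := by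
    by_contra! h
    exact hR ((injective_iff_map_eq_zero _).2 h)
  refine hX.subsingleton_of_mapOf_eq_zero hi.isSource_reflect hx0 (fun α l hs ht => ?_) hj
  have hα : Q.t α = i := hi.reflect_s_eq_iff.1 hs
  obtain rfl : Q.s α = l := (reflect_t_of_t hα).symm.trans ht
  rw [← R.equiv_outMap ⟨α, hα⟩, hx, Pi.zero_apply, map_zero]

theorem IsPlus.hom_eq_zero (hR : R.IsPlus) {E : QRep (Q.reflect i) k}
    (hE : ∀ j, j ≠ i → Subsingleton (E.sp j)) (φ : E ⟶ X') : φ = 0 := by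
  refine hom_ext fun j x => ?_
  by_cases hj : j = i
  · subst hj
    refine hR (funext fun α => (R.equiv _ (hi α)).injective ?_)
    have := hE _ (hi α)
    rw [R.equiv_outMap, R.equiv_outMap, ← app_mapOf,
      Subsingleton.elim (E.mapOf _ _ _ x) 0, app_zero, map_zero, map_zero]
  · have := hE j hj
    rw [Subsingleton.elim x 0, map_zero, map_zero]

theorem IsMinus.isProj (hR : R.IsMinus) {j : V} (hj : j ≠ i) (hX : X'.IsProj j) :
    X.IsProj j := by
  obtain ⟨x, hx⟩ := hX
  refine ⟨(R.equiv j hj).symm x, fun Z z => ?_⟩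
  let T := Z.reflPlusReflection hi
  have happ {φ : X ⟶ Z} {φ' : X' ⟶ Z.reflPlus hi} (h : Match R T φ φ') :
      T.equiv j hj (app φ j ((R.equiv j hj).symm x)) = app φ' j x := by
    rw [h, LinearEquiv.apply_symm_apply]
  obtain ⟨φ', hφ', huniq⟩ := hx _ (T.equiv j hj z)
  obtain ⟨φ, hφ⟩ := R.exists_match_left T φ'
  refine ⟨φ, (T.equiv j hj).injective ((happ hφ).trans hφ'), fun ψ hψ => ?_⟩
  obtain ⟨ψ', hψ'⟩ := R.exists_match_right T ψ
  obtain rfl := huniq ψ' ((happ hψ').symm.trans (congrArg _ hψ))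
  exact hψ'.eq_left hR hφ

theorem exists_isMinus (hi : Q.IsSink i) (X' : QRep (Q.reflect i) k) :
    ∃ (X : QRep Q k) (R : Reflection hi X X'), R.IsMinus := by
  classical
  exact ⟨minus hi X', minusReflection hi X', isMinus_minusReflection hi X'⟩

theorem isPlus_of_isProj (R : Reflection hi X X') {j : V} (hj : j ≠ i) (hX : X'.IsProj j) :
    R.IsPlus := by
  have : IsEmpty ((Q.reflect i).Path j i) := by
    have hne (l : V) : (Q.reflect i).Path j l → l ≠ i := by
      rintro (_ | ⟨α, -⟩)
      exacts [hj, hi.isSource_reflect α]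
    exact ⟨fun p => hne i p rfl⟩
  have : Subsingleton (X'.sp i) := by
    obtain ⟨y, hy⟩ := hX
    refine (Submodule.subsingleton_iff k).1 (subsingleton_of_bot_eq_top ?_)
    rw [← hy.span_range_pathMap i, Set.range_eq_empty, Submodule.span_empty]
  exact Function.injective_of_subsingleton _

end Reflection

variable {v : ℕ → V} {h : V → ℤ} {a b : ℕ} {X Y Z : QRep Q k}

theorem IsPreprojective.isProj (hY : IsPreprojective b Q v Y) (hb : ∀ c < b, v c ≠ v b) :
    Y.IsProj (v b) := by
  induction b generalizing Q v with
  | zero => exact hY.2.isProj hY.1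
  | succ b ih =>
    obtain ⟨hi, Y', S, -, hm, hY'⟩ := hY
    exact hm.isProj (hb 0 (by omega)).symm (ih hY' fun c hc => hb (c + 1) (by omega))

theorem isPreprojective_proj (H : SinkOrder Q h v) (hb : ∀ c < b, v c ≠ v b) :
    IsPreprojective b Q v (proj Q k (v b)) := by
  induction b generalizing Q v h with
  | zero => exact ⟨H.isSink, isSimpleAt_proj H.isSink⟩
  | succ b ih =>
    have hE := ih H.succ fun c hc => hb (c + 1) (by omega)
    obtain ⟨X, R, hR⟩ :=
      Reflection.exists_isMinus H.isSink (proj (Q.reflect (v 0)) k (v (b + 1)))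
    have hX : IsPreprojective (b + 1) Q v X :=
      ⟨H.isSink, _, R, R.isPlus_of_isProj (hb 0 (by omega)).symm (isProj_proj _ k _), hR, hE⟩
    obtain ⟨θ⟩ := (hX.isProj hb).nonempty_iso (isProj_proj Q k (v (b + 1)))
    exact hX.of_iso θ

/-! ### Almost split factorisations -/

variable (Q v a) in
/-- Morphisms which factor through one of the immediate successors of the `a`-th preprojective
representation. -/
def factorSet (X Z : QRep Q k) : Set (X ⟶ Z) :=
  {φ | ∃ (c : ℕ) (E : QRep Q k) (f : X ⟶ E) (ψ : E ⟶ Z),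
    Q.Follows v a c ∧ IsPreprojective c Q v E ∧ φ = f ≫ ψ}

theorem IsSimpleAt.mem_closure_factorSet (H : SinkOrder Q h v) (hX : X.IsSimpleAt (v 0))
    {φ : X ⟶ Z} (hφ : ¬ IsSplitMono φ) :
    φ ∈ AddSubmonoid.closure (factorSet Q v 0 X Z) := by
  obtain ⟨x, hx⟩ := hX.exists_ne_zero
  have hx := hX.isUniversal H.isSink hx
  obtain ⟨w, hw⟩ := (hX.isSplitMono_or_mem_range_inMap H.isSink φ).resolve_left hφ x
  choose ψ hψ _ using fun α : {α : A // Q.t α = v 0} =>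
    isUniversal_pathBasis_nil Q k (Q.s α) Z (w α)
  choose f hf _ using fun α : {α : A // Q.t α = v 0} =>
    hx (proj Q k (Q.s α)) ((proj Q k (Q.s α)).mapOf α.1 rfl α.2 (pathBasis Q k _ _ .nil))
  have hsum : φ = ∑ α, f α ≫ ψ α := hx.hom_ext <| by
    rw [← hw, app_sum, inMap_apply]
    exact Finset.sum_congr rfl fun α _ => by rw [app_comp, hf, app_mapOf, hψ]
  rw [hsum]
  refine AddSubmonoid.sum_mem _ fun α _ => AddSubmonoid.subset_closure ?_
  obtain ⟨b, hb, hfollows, hmin⟩ := H.exists_follows_zero α.2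
  exact ⟨b, _, f α, ψ α, hfollows, hb ▸ isPreprojective_proj H hmin, rfl⟩

theorem Reflection.exists_match_mem_closure_factorSet {hi : Q.IsSink (v 0)}
    {X' Z' : QRep (Q.reflect (v 0)) k} (R : Reflection hi X X') {T : Reflection hi Z Z'}
    (hT : T.IsPlus) {φ' : X' ⟶ Z'}
    (hφ' : φ' ∈ AddSubmonoid.closure
      (factorSet (Q.reflect (v 0)) (fun n => v (n + 1)) a X' Z')) :
    ∃ φ ∈ AddSubmonoid.closure (factorSet Q v (a + 1) X Z), Match R T φ φ' := by
  induction hφ' using AddSubmonoid.closure_induction with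
  | zero => exact ⟨0, AddSubmonoid.zero_mem _, Match.zero⟩
  | add f' g' _ _ hf hg =>
    obtain ⟨f, hmem, hf⟩ := hf
    obtain ⟨g, hmem', hg⟩ := hg
    exact ⟨f + g, AddSubmonoid.add_mem _ hmem hmem', hf.add hg⟩
  | mem φ' hφ' =>
    obtain ⟨c, E', f', ψ', hac, hE', rfl⟩ := hφ'
    obtain ⟨E, S, hm⟩ := exists_isMinus hi E'
    rcases S.isPlus_or_subsingleton hE'.isBrick with hp | hE0
    · obtain ⟨f, hf⟩ := R.exists_match_left S f'
      obtain ⟨ψ, hψ⟩ := S.exists_match_left T ψ'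
      exact ⟨f ≫ ψ, AddSubmonoid.subset_closure
        ⟨c + 1, E, f, ψ, follows_succ.2 hac, ⟨hi, E', S, hp, hm, hE'⟩, rfl⟩, hf.comp hψ⟩
    · rw [hT.hom_eq_zero hE0 ψ', Limits.comp_zero]
      exact ⟨0, AddSubmonoid.zero_mem _, Match.zero⟩

theorem IsPreprojective.mem_closure_factorSet (H : SinkOrder Q h v) (hX : IsPreprojective a Q v X)
    {φ : X ⟶ Z} (hφ : ¬ IsSplitMono φ) :
    φ ∈ AddSubmonoid.closure (factorSet Q v a X Z) := by
  induction a generalizing Q v h with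
  | zero => exact hX.2.mem_closure_factorSet H hφ
  | succ a ih =>
    obtain ⟨hi, X', R, -, hm, hX'⟩ := hX
    obtain ⟨φ', hφ'⟩ := R.exists_match_right (Z.reflPlusReflection hi) φ
    obtain ⟨ψ, hmem, hψ⟩ := R.exists_match_mem_closure_factorSet (Z.isPlus_reflPlusReflection hi)
      (ih H.succ hX' (mt (hφ'.isSplitMono hm) hφ))
    rwa [hφ'.eq_left hm hψ]

theorem IsPreprojective.finrank_hom_of_follows (H : SinkOrder Q h v)
    (hX : IsPreprojective a Q v X) (hY : IsPreprojective b Q v Y) (hab : Q.Follows v a b) :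
    Module.finrank k (X ⟶ Y) = 1 := by
  induction a generalizing Q h v b with
  | zero =>
    have hP := hY.isProj (hab.forall_ne H.isSink)
    obtain ⟨α, hs, ht⟩ := hab.exists_arrow H.isSink
    exact hX.2.finrank_hom_isProj H.isHeight H.isSimple H.isSink ht (hs ▸ hP)
  | succ a ih =>
    obtain ⟨b, rfl⟩ := Nat.exists_eq_succ_of_ne_zero (Nat.ne_zero_of_lt hab.1)
    obtain ⟨hi, X', R, -, hm, hX'⟩ := hX
    obtain ⟨_, Y', S, hp, -, hY'⟩ := hY
    exact (Reflection.homEquiv hm hp).finrank_eq.trans (ih H.succ hX' hY' (follows_succ.1 hab))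

theorem IsPreprojective.factorsTrivially_of_follows (H : SinkOrder Q h v)
    (hX : IsPreprojective a Q v X) (hY : IsPreprojective b Q v Y) (hab : Q.Follows v a b)
    {φ : X ⟶ Y} (hφ : φ ≠ 0) : FactorsTrivially φ := by
  induction a generalizing Q h v b with
  | zero =>
    have hP := hY.isProj (hab.forall_ne H.isSink)
    obtain ⟨α, hs, ht⟩ := hab.exists_arrow H.isSink
    exact hX.2.factorsTrivially H.isHeight H.isSimple H.isSink ht (hs ▸ hP) hφ
  | succ a ih =>
    obtain ⟨b, rfl⟩ := Nat.exists_eq_succ_of_ne_zero (Nat.ne_zero_of_lt hab.1)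
    obtain ⟨hi, X', R, -, hmX, hX'⟩ := hX
    obtain ⟨_, Y', S, -, hmY, hY'⟩ := hY
    rintro Z φ₁ φ₂ rfl
    obtain ⟨φ₁', h₁⟩ := R.exists_match_right (Z.reflPlusReflection hi) φ₁
    obtain ⟨φ₂', h₂⟩ := (Z.reflPlusReflection hi).exists_match_right S φ₂
    have hne : φ₁' ≫ φ₂' ≠ 0 := fun h0 => hφ <|
      (h₁.comp h₂).eq_left hmX (h0 ▸ Reflection.Match.zero)
    exact (ih H.succ hX' hY' (follows_succ.1 hab) hne _ φ₁' φ₂' rfl).imp (h₁.isSplitMono hmX)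
      (h₂.isSplitEpi hmY)

/-! ### Irreducible morphisms between preprojective representations -/

namespace IsPreprojective

theorem le_of_ne_zero (hX : IsPreprojective a Q v X) (hY : IsPreprojective b Q v Y) {φ : X ⟶ Y}
    (hφ : φ ≠ 0) : a ≤ b :=
  not_lt.1 fun hlt => hφ (hX.hom_eq_zero hY hlt φ)

theorem isIrreducible_of_follows (H : SinkOrder Q h v) (hX : IsPreprojective a Q v X)
    (hY : IsPreprojective b Q v Y) (hab : Q.Follows v a b) {φ : X ⟶ Y} (hφ : φ ≠ 0) :
    IsIrreducible φ :=
  (hX.factorsTrivially_of_follows H hY hab hφ).isIrreducible (hX.not_isSplitMono hY hab.1.ne φ)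
    (hX.not_isSplitEpi hY hab.1.ne φ)

theorem isStronglyReducible (H : SinkOrder Q h v) (hX : IsPreprojective a Q v X)
    (hY : IsPreprojective b Q v Y) (hab : ¬ Q.Follows v a b) {φ : X ⟶ Y}
    (hφ : ¬ IsSplitMono φ) : IsStronglyReducible φ := by
  replace hφ := hX.mem_closure_factorSet H hφ
  induction hφ using AddSubmonoid.closure_induction with
  | zero => exact isStronglyReducible_zero
  | add φ₁ φ₂ _ _ h₁ h₂ => exact h₁.add h₂
  | mem φ hφ =>
    obtain ⟨c, E, f, ψ, hac, hE, rfl⟩ := hφ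
    by_cases hψ : ψ = 0
    · rw [hψ, Limits.comp_zero]
      exact isStronglyReducible_zero
    have hcb : c < b := (hE.le_of_ne_zero hY hψ).lt_of_ne fun hcb => hab (hcb ▸ hac)
    refine ⟨E, f, ψ, hE.finDim, rfl, fun ρ => ?_, fun ρ => ?_⟩
    · rw [hE.hom_eq_zero hX hac.1 ρ, Limits.comp_zero]
    · rw [hY.hom_eq_zero hE hcb ρ, Limits.zero_comp]

theorem follows_of_isIrreducible (H : SinkOrder Q h v) (hX : IsPreprojective a Q v X)
    (hY : IsPreprojective b Q v Y) {φ : X ⟶ Y} (hφ : IsIrreducible φ) : Q.Follows v a b := by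
  by_contra hab
  exact (hX.isStronglyReducible H hY hab hφ.not_splitMono).not_isIrreducible hX.isBrick.nonzero
    hY.isBrick.nonzero hφ

theorem exists_isIrreducible_iff (H : SinkOrder Q h v) (hX : IsPreprojective a Q v X)
    (hY : IsPreprojective b Q v Y) : (∃ φ : X ⟶ Y, IsIrreducible φ) ↔ Q.Follows v a b := by
  refine ⟨fun ⟨φ, hφ⟩ => hX.follows_of_isIrreducible H hY hφ, fun hab => ?_⟩
  have : Nontrivial (X ⟶ Y) := Module.nontrivial_of_finrank_pos (R := k)
    ((hX.finrank_hom_of_follows H hY hab).symm ▸ one_pos)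
  obtain ⟨φ, hφ⟩ := exists_ne (0 : X ⟶ Y)
  exact ⟨φ, hX.isIrreducible_of_follows H hY hab hφ⟩

theorem exists_eq_smul_of_isIrreducible (H : SinkOrder Q h v) (hX : IsPreprojective a Q v X)
    (hY : IsPreprojective b Q v Y) {φ : X ⟶ Y} (hφ : IsIrreducible φ) (φ' : X ⟶ Y) :
    ∃ c : k, φ' = c • φ := by
  have hφ0 : φ ≠ 0 := hφ.ne_zero hX.isBrick.nonzero hY.isBrick.nonzero
  obtain ⟨c, hc⟩ := exists_smul_eq_of_finrank_eq_one
    (hX.finrank_hom_of_follows H hY (hX.follows_of_isIrreducible H hY hφ)) hφ0 φ'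
  exact ⟨c, hc.symm⟩

theorem isSumOfIrrComp (H : SinkOrder Q h v) (hX : IsPreprojective a Q v X)
    (hY : IsPreprojective b Q v Y) {φ : X ⟶ Y} (hφ : ¬ IsIso φ) : IsSumOfIrrComp φ := by
  induction hn : b - a using Nat.strong_induction_on generalizing a X with
  | _ n ih =>
  by_cases hab : a = b
  · subst hab
    rw [(hX.isIso_or_eq_zero hY φ).resolve_left hφ]
    exact AddSubmonoid.zero_mem _
  refine AddSubmonoid.closure_le.2 ?_ (hX.mem_closure_factorSet H (hX.not_isSplitMono hY hab φ))
  rintro _ ⟨c, E, f, ψ, hac, hE, rfl⟩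
  by_cases h0 : f ≫ ψ = 0
  · rw [h0]
    exact AddSubmonoid.zero_mem _
  have hf : f ≠ 0 := by
    rintro rfl
    exact h0 Limits.zero_comp
  have hψ : ψ ≠ 0 := by
    rintro rfl
    exact h0 Limits.comp_zero
  have hcb := hE.le_of_ne_zero hY hψ
  by_cases hi : IsIso ψ
  · refine AddSubmonoid.subset_closure (.irr _ hX.isIndec hY.isIndec ?_)
    obtain rfl : c = b := by_contra fun hne => hE.not_isSplitMono hY hne ψ inferInstance
    exact hX.isIrreducible_of_follows H hY hac h0
  · have hirr : IsIrrComp f :=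
      .irr f hX.isIndec hE.isIndec (hX.isIrreducible_of_follows H hE hac hf)
    exact hirr.comp_isSumOfIrrComp (ih (b - c) (by have := hac.1; omega) hE hi rfl)

/-! ### Powers of the radical -/

theorem exists_follows_of_ne_zero (H : SinkOrder Q h v) (hX : IsPreprojective a Q v X)
    {φ : X ⟶ Y} (hφ : ¬ IsSplitMono φ) (hφ0 : φ ≠ 0) :
    ∃ (c : ℕ) (E : QRep Q k) (ψ : E ⟶ Y), Q.Follows v a c ∧ IsPreprojective c Q v E ∧ ψ ≠ 0 := by
  by_contra! hall
  refine hφ0 (AddSubmonoid.closure_le.2 ?_ (hX.mem_closure_factorSet H hφ) :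
    φ ∈ (⊥ : AddSubmonoid (X ⟶ Y)))
  rintro _ ⟨c, E, f, ψ, hac, hE, rfl⟩
  exact (congrArg (f ≫ ·) (hall c E ψ hac hE)).trans Limits.comp_zero

theorem level_le (H : SinkOrder Q h v) (hX : IsPreprojective a Q v X)
    (hY : IsPreprojective b Q v Y) {φ : X ⟶ Y} (hφ : φ ≠ 0) : level h v a ≤ level h v b := by
  induction hn : b - a using Nat.strong_induction_on generalizing a X with
  | _ n ih =>
  by_cases hab : a = b
  · rw [hab]
  obtain ⟨c, E, ψ, hac, hE, hψ⟩ :=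
    hX.exists_follows_of_ne_zero H (hX.not_isSplitMono hY hab φ) hφ
  have hcb := hE.le_of_ne_zero hY hψ
  have hle := ih (b - c) (by have := hac.1; omega) hE hψ rfl
  rw [H.level_of_follows hac] at hle
  omega

theorem eq_zero_of_mem_radPow (H : SinkOrder Q h v) (hX : IsPreprojective a Q v X)
    (hY : IsPreprojective b Q v Y) {m : ℕ} (hm : level h v b < level h v a + m)
    {φ : X ⟶ Y} (hφ : φ ∈ radPow m X Y) : φ = 0 := by
  induction m generalizing a X with
  | zero =>
    by_contra h0
    exact hm.not_ge ((add_zero _).trans_le (hX.level_le H hY h0))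
  | succ m ih =>
    obtain ⟨Z, φ', φ'', -, h', h'', rfl⟩ := hφ
    replace h' := hX.mem_closure_factorSet H (not_isSplitMono_of_mem_rad hX.isIndec h')
    induction h' using AddSubmonoid.closure_induction with
    | zero => exact Limits.zero_comp
    | add f g _ _ hf hg => rw [Preadditive.add_comp, hf, hg, add_zero]
    | mem f hf =>
      obtain ⟨c, E, f, ψ, hac, hE, rfl⟩ := hf
      have hl := H.level_of_follows hac
      rw [Category.assoc, ih hE (by push_cast at hm; omega) (comp_mem_radPow ψ h''),
        Limits.comp_zero]

end IsPreprojective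

/-- Finite direct sums of preprojective representations of level `d`. -/
inductive LevelSum (Q : FinQuiver V A) (h : V → ℤ) (v : ℕ → V) (d : ℤ) : QRep Q k → Prop
  | preprojective {X : QRep Q k} {a : ℕ} (hX : IsPreprojective a Q v X) (hd : level h v a = d) :
      LevelSum Q h v d X
  | zero {X : QRep Q k} (hX : X.IsZeroRep) : LevelSum Q h v d X
  | biprod {X Y : QRep Q k} (hX : LevelSum Q h v d X) (hY : LevelSum Q h v d Y) :
      LevelSum Q h v d (X ⊞ Y)

theorem IsPreprojective.exists_factor_levelSum (H : SinkOrder Q h v)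
    (hX : IsPreprojective a Q v X) {φ : X ⟶ Y} (hφ : ¬ IsSplitMono φ) :
    ∃ (Z : QRep Q k) (f : X ⟶ Z) (g : Z ⟶ Y),
      LevelSum Q h v (level h v a + 1) Z ∧ φ = f ≫ g := by
  replace hφ := hX.mem_closure_factorSet H hφ
  induction hφ using AddSubmonoid.closure_induction with
  | zero =>
    exact ⟨zeroRep Q k, 0, 0, .zero (isZeroRep_zeroRep Q k), Limits.comp_zero.symm⟩
  | add φ₁ φ₂ _ _ h₁ h₂ =>
    obtain ⟨Z₁, f₁, g₁, hZ₁, rfl⟩ := h₁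
    obtain ⟨Z₂, f₂, g₂, hZ₂, rfl⟩ := h₂
    exact ⟨_, _, _, hZ₁.biprod hZ₂, Limits.biprod.lift_desc.symm⟩
  | mem φ hφ =>
    obtain ⟨c, E, f, ψ, hac, hE, rfl⟩ := hφ
    exact ⟨E, f, ψ, .preprojective hE (H.level_of_follows hac), rfl⟩

namespace LevelSum

variable {d : ℤ}

theorem finDim (hX : LevelSum Q h v d X) : X.FinDim := by
  induction hX with
  | preprojective hX _ => exact hX.finDim
  | zero hX => exact hX.finDim
  | biprod _ _ hX hY => exact hX.biprod hY

theorem hom_eq_zero (H : SinkOrder Q h v) {d' : ℤ} (hX : LevelSum Q h v d X)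
    (hY : LevelSum Q h v d' Y) (hd : d' < d) (φ : X ⟶ Y) : φ = 0 := by
  induction hX with
  | zero hX => exact hX.eq_zero_of_src φ
  | biprod _ _ h₁ h₂ =>
    exact Limits.biprod.hom_ext' _ _ ((h₁ _).trans Limits.comp_zero.symm)
      ((h₂ _).trans Limits.comp_zero.symm)
  | preprojective hX ha =>
    induction hY with
    | zero hY => exact hY.eq_zero_of_tgt φ
    | biprod _ _ h₁ h₂ =>
      exact Limits.biprod.hom_ext _ _ ((h₁ _).trans Limits.zero_comp.symm)
        ((h₂ _).trans Limits.zero_comp.symm)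
    | preprojective hY hb =>
      by_contra h0
      exact hd.not_ge (ha ▸ hb ▸ hX.level_le H hY h0)

theorem exists_factor (H : SinkOrder Q h v) (hX : LevelSum Q h v d X)
    (hY : IsPreprojective b Q v Y) (hd : d < level h v b) (φ : X ⟶ Y) :
    ∃ (Z : QRep Q k) (f : X ⟶ Z) (g : Z ⟶ Y), LevelSum Q h v (d + 1) Z ∧ φ = f ≫ g := by
  induction hX with
  | zero hX => exact ⟨_, 𝟙 _, φ, .zero hX, (Category.id_comp φ).symm⟩
  | biprod _ _ h₁ h₂ =>
    obtain ⟨Z₁, f₁, g₁, hZ₁, hφ₁⟩ := h₁ (Limits.biprod.inl ≫ φ)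
    obtain ⟨Z₂, f₂, g₂, hZ₂, hφ₂⟩ := h₂ (Limits.biprod.inr ≫ φ)
    exact ⟨_, Limits.biprod.map f₁ f₂, Limits.biprod.desc g₁ g₂, hZ₁.biprod hZ₂,
      Limits.biprod.hom_ext' _ _ (by simpa using hφ₁) (by simpa using hφ₂)⟩
  | @preprojective X a hX ha =>
    have hab : a ≠ b := by
      rintro rfl
      exact hd.ne' ha
    exact ha ▸ hX.exists_factor_levelSum H (hX.not_isSplitMono hY hab φ)

theorem mem_radPow (H : SinkOrder Q h v) {m : ℕ} (hX : LevelSum Q h v d X)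
    (hY : IsPreprojective b Q v Y) (hd : level h v b = d + m) (φ : X ⟶ Y) :
    φ ∈ radPow m X Y := by
  induction m generalizing d X with
  | zero => trivial
  | succ m ih =>
    push_cast at hd
    obtain ⟨Z, f, g, hZ, rfl⟩ := hX.exists_factor H hY (by omega) φ
    exact ⟨Z, f, g, hZ.finDim, mem_rad_of_hom_eq_zero (hZ.hom_eq_zero H hX (by omega)) f,
      ih hZ (by omega) g, rfl⟩

end LevelSum

theorem IsPreprojective.exists_radPow (H : SinkOrder Q h v) (hX : IsPreprojective a Q v X)
    (hY : IsPreprojective b Q v Y) :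
    ∃ d : ℕ, (∀ m ≤ d, radPow m X Y = Set.univ) ∧ radPow (d + 1) X Y = {0} := by
  by_cases hne : ∃ φ : X ⟶ Y, φ ≠ 0
  · obtain ⟨φ, hφ⟩ := hne
    obtain ⟨d, hd⟩ := Int.le.dest (hX.level_le H hY hφ)
    have hX' : LevelSum Q h v (level h v a) X := .preprojective hX rfl
    refine ⟨d, fun m hm => Set.eq_univ_of_forall fun ψ =>
      radPow_antitone X Y hm (hX'.mem_radPow H hY hd.symm ψ), Set.eq_singleton_iff_unique_mem.2
      ⟨zero_mem_radPow _ X Y, fun ψ hψ => hX.eq_zero_of_mem_radPow H hY ?_ hψ⟩⟩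
    push_cast
    omega
  · push Not at hne
    refine ⟨0, fun m hm => ?_, Set.eq_singleton_iff_unique_mem.2
      ⟨zero_mem_radPow _ X Y, fun ψ _ => hne ψ⟩⟩
    rw [Nat.le_zero.1 hm]
    rfl

end QRep

/-! ### Heights of Dynkin quivers -/

theorem exists_potential {V : Type} [LinearOrder V] [WellFoundedLT V] {G : SimpleGraph V}
    (hG : ∀ ⦃x y z⦄, G.Adj y x → G.Adj z x → y < x → z < x → y = z) {w : V → V → ℤ}
    (hw : ∀ ⦃x y⦄, G.Adj x y → w y x = -w x y) :
    ∃ h : V → ℤ, ∀ ⦃x y⦄, G.Adj x y → h x = h y + w x y := by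
  classical
  let step (x : V) (h : ∀ y, y < x → ℤ) : ℤ :=
    if hx : ∃ y, y < x ∧ G.Adj y x then h hx.choose hx.choose_spec.1 + w x hx.choose else 0
  let h : V → ℤ := wellFounded_lt.fix step
  have h_eq ⦃x y : V⦄ (hyx : G.Adj y x) (hlt : y < x) : h x = h y + w x y := by
    have hx : ∃ y, y < x ∧ G.Adj y x := ⟨y, hlt, hyx⟩
    have hy : hx.choose = y := hG hx.choose_spec.2 hyx hx.choose_spec.1 hlt
    calc h x = step x fun y _ => h y := wellFounded_lt.fix_eq step x
      _ = h hx.choose + w x hx.choose := dif_pos hx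
      _ = h y + w x y := by rw [hy]
  refine ⟨h, fun x y hxy => ?_⟩
  rcases hxy.ne.lt_or_gt with hlt | hlt
  · rw [h_eq hxy hlt, hw hxy, neg_add_cancel_right]
  · exact h_eq hxy.symm hlt

theorem eq_of_forkGraph_adj_of_lt {n b : ℕ} {x y z : Fin n} (hy : (forkGraph n b).Adj y x)
    (hz : (forkGraph n b).Adj z x) (hyx : y < x) (hzx : z < x) : y = z := by
  simp only [forkGraph, SimpleGraph.fromRel_adj] at hy hz
  omega

theorem IsDynkinDiagram.eq_of_adj_of_lt {n : ℕ} {Γ : SimpleGraph (Fin n)}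
    (hΓ : IsDynkinDiagram n Γ) {x y z : Fin n} (hy : Γ.Adj y x) (hz : Γ.Adj z x) (hyx : y < x)
    (hzx : z < x) : y = z := by
  cases hΓ with
  | A n hn =>
    rw [SimpleGraph.pathGraph_adj] at hy hz
    omega
  | _ => exact eq_of_forkGraph_adj_of_lt hy hz hyx hzx

namespace FinQuiver

section Dynkin

variable {V A : Type} {Q : FinQuiver V A}

theorem IsDynkin.isSimple (hQ : Q.IsDynkin) : Q.IsSimple := fun α β hs ht => by
  obtain ⟨n, Γ, e, -, hadj, huniq⟩ := hQ
  exact (huniq _ _ (hadj α)).unique (.inl ⟨rfl, rfl⟩) (.inl ⟨hs.symm, ht.symm⟩)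

theorem IsDynkin.exists_isHeight (hQ : Q.IsDynkin) : ∃ h, Q.IsHeight h := by
  classical
  obtain ⟨n, Γ, e, hΓ, hadj, huniq⟩ := hQ
  let IsArrow (x y : Fin n) : Prop := ∃ α, e (Q.s α) = x ∧ e (Q.t α) = y
  have isArrow_or {x y : Fin n} (hxy : Γ.Adj x y) : IsArrow x y ∨ IsArrow y x := by
    obtain ⟨α, hα, -⟩ := huniq (e.symm x) (e.symm y) (by simpa using hxy)
    simp only [Equiv.eq_symm_apply] at hα
    exact hα.imp (fun h => ⟨α, h⟩) fun h => ⟨α, h⟩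
  have not_isArrow {x y : Fin n} (hxy : IsArrow x y) : ¬ IsArrow y x := by
    rintro ⟨β, hs, ht⟩
    obtain ⟨α, rfl, rfl⟩ := hxy
    have hαβ : α = β := (huniq _ _ (hadj α)).unique (.inl ⟨rfl, rfl⟩)
      (.inr ⟨e.injective hs, e.injective ht⟩)
    exact (hadj α).ne (hαβ ▸ hs)
  obtain ⟨h, hh⟩ := exists_potential (fun _ _ _ => hΓ.eq_of_adj_of_lt)
    (w := fun x y => if IsArrow x y then 1 else -1) fun x y hxy => by
      rcases isArrow_or hxy with hxy | hyx
      · rw [if_pos hxy, if_neg (not_isArrow hxy)]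
      · rw [if_pos hyx, if_neg (not_isArrow hyx), neg_neg]
  exact ⟨h ∘ e, fun α => (hh (hadj α)).trans (by rw [if_pos ⟨α, rfl, rfl⟩]; rfl)⟩

end Dynkin

/-! ### Periodic sequences of sinks -/

section Cycle

variable {V : Type} {L : List V} (hL : 0 < L.length)

variable (L) in
/-- The periodic sequence which repeats the list `L`. -/
def cycle (t : ℕ) : V := L[t % L.length]'(Nat.mod_lt t hL)

theorem cycle_of_lt {t : ℕ} (ht : t < L.length) : cycle L hL t = L[t] := by
  simp only [cycle, Nat.mod_eq_of_lt ht]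

theorem cycle_add_mul_length (t m : ℕ) : cycle L hL (t + m * L.length) = cycle L hL t := by
  simp only [cycle, Nat.add_mul_mod_self_right]

theorem cycle_add_length (t : ℕ) : cycle L hL (t + L.length) = cycle L hL t := by
  simp only [cycle, Nat.add_mod_right]

theorem cycle_idxOf [DecidableEq V] {i : V} (hi : i ∈ L) : cycle L hL (L.idxOf i) = i := by
  rw [cycle_of_lt hL (List.idxOf_lt_length_iff.2 hi), List.getElem_idxOf]

theorem map_range_cycle : (List.range L.length).map (cycle L hL) = L :=
  List.ext_getElem (by simp) fun t _ ht => by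
    rw [List.getElem_map, List.getElem_range, cycle_of_lt hL ht]

theorem cycle_eq_iff (hd : L.Nodup) {p q : ℕ} :
    cycle L hL p = cycle L hL q ↔ p ≡ q [MOD L.length] :=
  hd.getElem_inj_iff

theorem forall_cycle_ne_iff (hd : L.Nodup) {p q : ℕ} :
    (∀ c, p < c → c < q → cycle L hL c ≠ cycle L hL q) ↔ q ≤ p + L.length := by
  refine ⟨fun h => ?_, fun h c hpc hcq hc => ?_⟩
  · by_contra! hlt
    refine h (q - L.length) (by omega) (by omega) ?_
    rw [← cycle_add_length, Nat.sub_add_cancel (by omega)]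
  · have hdvd : L.length ∣ q - c := (Nat.modEq_iff_dvd' hcq.le).1 ((cycle_eq_iff hL hd).1 hc)
    have := Nat.le_of_dvd (by omega) hdvd
    omega

end Cycle

variable {V A : Type} [DecidableEq V] {Q : FinQuiver V A} {L : List V}

theorem sinkSequence_append {L L' : List V} :
    Q.SinkSequence (L ++ L') ↔ Q.SinkSequence L ∧ (Q.reflectList L).SinkSequence L' := by
  induction L generalizing Q with
  | nil => exact (iff_of_eq (true_and _)).symm
  | cons i L ih => exact (and_congr_right fun _ => ih).trans and_assoc.symm

theorem IsAdmissible.sinkSequence_cycle (hQ : Q.IsAdmissible L) (hL : 0 < L.length) (n : ℕ) :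
    Q.SinkSequence ((List.range n).map (cycle L hL)) := by
  have hmul (m : ℕ) : Q.SinkSequence ((List.range (L.length * m)).map (cycle L hL)) := by
    induction m with
    | zero => trivial
    | succ m ih =>
      rw [Nat.mul_succ, add_comm, List.range_add, List.map_append, map_range_cycle, List.map_map,
        sinkSequence_append, hQ.reflectList_eq]
      refine ⟨hQ.sinks, ?_⟩
      convert ih using 3
      exact funext fun t => by rw [Function.comp_apply, add_comm, cycle_add_length]
  obtain ⟨m, hm⟩ := Nat.exists_eq_add_of_le (Nat.le_mul_of_pos_left n hL)
  have := hmul n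
  rw [hm, List.range_add, List.map_append, sinkSequence_append] at this
  exact this.1

theorem IsAdmissible.sinkOrder (hQ : Q.IsAdmissible L) (hL : 0 < L.length) {h : V → ℤ}
    (hh : Q.IsHeight h) (hsimple : Q.IsSimple) : SinkOrder Q h (cycle L hL) where
  isHeight := hh
  isSimple := hsimple
  sinks := hQ.sinkSequence_cycle hL
  often j n := ⟨L.idxOf j + n * L.length,
    le_add_left (Nat.le_mul_of_pos_right n hL), by
      rw [cycle_add_mul_length, cycle_idxOf hL (hQ.mem j)]⟩

theorem SinkSequence.idxOf_lt (hL : Q.SinkSequence L) {α : A} (hα : Q.t α ∈ L) :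
    L.idxOf (Q.t α) < L.idxOf (Q.s α) := by
  induction L generalizing Q with
  | nil => exact absurd hα List.not_mem_nil
  | cons i L ih =>
    rw [List.idxOf_cons_ne _ (hL.1 α).symm]
    by_cases hi : Q.t α = i
    · rw [hi, List.idxOf_cons_self]
      exact Nat.succ_pos _
    · rw [List.idxOf_cons_ne _ (Ne.symm hi), Nat.succ_lt_succ_iff]
      have := ih hL.2 (by
        rw [hL.1.reflect_t_of_ne hi]
        exact (List.mem_cons.1 hα).resolve_left hi)
      rwa [hL.1.reflect_t_of_ne hi, hL.1.reflect_s_of_ne hi] at this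

theorem lt_and_le_add_iff {n a b m m' : ℕ} (ha : a < n) (hb : b < n) :
    (a + m * n < b + m' * n ∧ b + m' * n ≤ a + m * n + n) ↔
      (m = m' ∧ a < b) ∨ (m' = m + 1 ∧ b ≤ a) := by
  rcases lt_trichotomy m m' with h | rfl | h
  · obtain ⟨d, rfl⟩ := Nat.exists_eq_add_of_lt h
    rcases Nat.eq_zero_or_pos d with rfl | hd
    · rw [add_zero, Nat.succ_mul]
      omega
    · have := Nat.le_mul_of_pos_left n hd
      rw [Nat.add_mul, Nat.add_mul, one_mul]
      omega
  · omega
  · have := Nat.mul_le_mul_right n (Nat.succ_le_of_lt h)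
    rw [Nat.succ_mul] at this
    omega

theorem IsAdmissible.follows_iff (hQ : Q.IsAdmissible L) (hL : 0 < L.length) (i j : V)
    (m m' : ℕ) :
    Q.Follows (cycle L hL) (L.idxOf i + m * L.length) (L.idxOf j + m' * L.length) ↔
      (m = m' ∧ ∃ α, Q.s α = j ∧ Q.t α = i) ∨ (m' = m + 1 ∧ ∃ α, Q.s α = i ∧ Q.t α = j) := by
  rw [Follows, forall_cycle_ne_iff hL hQ.nodup, ← and_assoc,
    lt_and_le_add_iff (List.idxOf_lt_length_iff.2 (hQ.mem i))
      (List.idxOf_lt_length_iff.2 (hQ.mem j)),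
    cycle_add_mul_length, cycle_add_mul_length, cycle_idxOf hL (hQ.mem i),
    cycle_idxOf hL (hQ.mem j)]
  have hlt (α : A) : L.idxOf (Q.t α) < L.idxOf (Q.s α) := hQ.sinks.idxOf_lt (hQ.mem _)
  constructor
  · rintro ⟨hm, α, ⟨rfl, rfl⟩ | ⟨rfl, rfl⟩⟩
    · exact .inr ⟨(hm.resolve_left fun h => (hlt α).not_gt h.2).1, α, rfl, rfl⟩
    · exact .inl ⟨(hm.resolve_right fun h => (hlt α).not_ge h.2).1, α, rfl, rfl⟩
  · rintro (⟨rfl, α, rfl, rfl⟩ | ⟨rfl, α, rfl, rfl⟩)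
    · exact ⟨.inl ⟨rfl, hlt α⟩, α, .inr ⟨rfl, rfl⟩⟩
    · exact ⟨.inr ⟨rfl, (hlt α).le⟩, α, .inl ⟨rfl, rfl⟩⟩

end FinQuiver

/-! ### Coxeter functors -/

namespace QRep

open FinQuiver

variable {V A : Type} [DecidableEq V] {Q : FinQuiver V A} {k : Type u} [Field k] {L : List V}

section Plus

variable [Fintype A] {X : QRep Q k}

theorem isZeroRep_plusAlong (hL : Q.SinkSequence L) (hX : X.IsZeroRep) :
    (plusAlong L Q hL X).IsZeroRep := by
  induction L generalizing Q with
  | nil => exact hX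
  | cons i L ih => exact ih hL.2 ((X.isPlus_reflPlusReflection hL.1).isZeroRep fun j _ => hX j)

theorem isZeroRep_coxPlus_iterate (hQ : Q.IsAdmissible L) (n : ℕ) (hX : X.IsZeroRep) :
    ((coxPlus hQ)^[n] X).IsZeroRep := by
  induction n generalizing X with
  | zero => exact hX
  | succ _ ih => exact ih (isZeroRep_plusAlong hQ.sinks hX : (coxPlus hQ X).IsZeroRep)

theorem isProj_reflPlus {i j : V} (hi : Q.IsSink i) (hj : j ≠ i) (hX : X.IsProj j) :
    (X.reflPlus hi).IsProj j := by
  have hP := isProj_proj (Q.reflect i) k j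
  obtain ⟨Y, R, hR⟩ := Reflection.exists_isMinus hi (proj (Q.reflect i) k j)
  obtain ⟨θ⟩ := (hR.isProj hj hP).nonempty_iso hX
  obtain ⟨θ'⟩ := (R.isPlus_of_isProj hj hP).nonempty_iso (X.isPlus_reflPlusReflection hi) θ
  exact hP.of_iso θ'

theorem isZeroRep_plusAlong_of_isProj (hL : Q.SinkSequence L) {j : V} (hj : j ∈ L)
    (hX : X.IsProj j) : (plusAlong L Q hL X).IsZeroRep := by
  induction L generalizing Q with
  | nil => exact absurd hj List.not_mem_nil
  | cons i L ih =>
    by_cases hji : j = i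
    · subst hji
      exact isZeroRep_plusAlong hL.2
        ((X.isPlus_reflPlusReflection hL.1).isZeroRep (hX.isSimpleAt hL.1).subsingleton)
    · exact ih hL.2 ((List.mem_cons.1 hj).resolve_left hji) (isProj_reflPlus hL.1 hji hX)

theorem IsPreprojective.ofEq {Q' : FinQuiver V A} (e : Q = Q') {a : ℕ} {v : ℕ → V}
    (hX : IsPreprojective a Q v X) : IsPreprojective a Q' v (X.ofEq e) := by
  subst e
  exact hX

end Plus

variable [DecidableEq A]

theorem isZeroRep_minusAlong (hL : Q.SinkSequence L) {X : QRep (Q.reflectList L) k}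
    (hX : X.IsZeroRep) : (minusAlong L Q hL X).IsZeroRep := by
  induction L generalizing Q with
  | nil => exact hX
  | cons i L ih => exact isZeroRep_minus hL.1 _ (ih hL.2 hX)

variable [Fintype A]

theorem IsPreprojective.minusAlong_of_not_isZeroRep (hL : Q.SinkSequence L) {a : ℕ} {v : ℕ → V}
    (hv : ∀ (t : ℕ) (ht : t < L.length), v t = L[t]) {X : QRep (Q.reflectList L) k}
    (hX : IsPreprojective a (Q.reflectList L) (fun t => v (t + L.length)) X)
    (h0 : ¬ (minusAlong L Q hL X).IsZeroRep) :
    IsPreprojective (a + L.length) Q v (minusAlong L Q hL X) := by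
  induction L generalizing Q v with
  | nil => exact hX
  | cons i L ih =>
    obtain rfl : v 0 = i := hv 0 (Nat.succ_pos _)
    let X' := minusAlong L (Q.reflect (v 0)) hL.2 X
    let R := minusReflection hL.1 X'
    have hR : R.IsMinus := isMinus_minusReflection hL.1 X'
    have hX' : IsPreprojective (a + L.length) _ (fun t => v (t + 1)) X' :=
      ih hL.2 (fun t ht => hv (t + 1) (Nat.succ_lt_succ ht)) hX
        fun hz => h0 (hR.isZeroRep fun j _ => hz j)
    exact ⟨hL.1, X', R,
      (R.isPlus_or_subsingleton hX'.isBrick).resolve_right fun hz => h0 (hR.isZeroRep hz), hR, hX'⟩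

theorem IsPreprojective.coxMinus_iterate (hQ : Q.IsAdmissible L) (hL : 0 < L.length) {a : ℕ}
    {X : QRep Q k} (hX : IsPreprojective a Q (cycle L hL) X) (m : ℕ)
    (h0 : ¬ ((coxMinus hQ)^[m] X).IsZeroRep) :
    IsPreprojective (a + m * L.length) Q (cycle L hL) ((coxMinus hQ)^[m] X) := by
  induction m with
  | zero => simpa using hX
  | succ m ih =>
    rw [Function.iterate_succ_apply'] at h0 ⊢
    have hm : ¬ ((coxMinus hQ)^[m] X).IsZeroRep := fun hz => h0 (isZeroRep_minusAlong hQ.sinks hz)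
    rw [Nat.succ_mul, ← add_assoc]
    refine minusAlong_of_not_isZeroRep hQ.sinks (fun t ht => cycle_of_lt hL ht) ?_ h0
    simp only [cycle_add_length]
    exact (ih hm).ofEq hQ.reflectList_eq.symm

theorem exists_isPreprojective_of_iso_coxPow (hQ : Q.IsAdmissible L) (hL : 0 < L.length)
    {h : V → ℤ} (H : SinkOrder Q h (cycle L hL)) {X : QRep Q k} (hX : ¬ X.IsZeroRep) {i : V}
    {r : ℤ} (θ : X ≅ coxPow hQ r (proj Q k i)) :
    ∃ m : ℕ, r = -m ∧ IsPreprojective (L.idxOf i + m * L.length) Q (cycle L hL) X := by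
  have hi : L.idxOf i < L.length := List.idxOf_lt_length_iff.2 (hQ.mem i)
  have hP : IsPreprojective (L.idxOf i) Q (cycle L hL) (proj Q k i) := by
    have := isPreprojective_proj (k := k) H fun c (hc : c < L.idxOf i) hci =>
      hc.ne (((cycle_eq_iff hL hQ.nodup).1 hci).eq_of_lt_of_lt (hc.trans hi) hi)
    rwa [cycle_idxOf hL (hQ.mem i)] at this
  have hne : ¬ (coxPow hQ r (proj Q k i)).IsZeroRep := fun hz => hX (hz.of_iso θ.symm)
  match r, θ, hne with
  | .ofNat 0, θ, _ => exact ⟨0, by simp, by simpa using hP.of_iso θ.symm⟩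
  | .ofNat (n + 1), _, hne =>
    exact absurd (isZeroRep_coxPlus_iterate hQ n
      (isZeroRep_plusAlong_of_isProj hQ.sinks (hQ.mem i) (isProj_proj Q k i) :
        (coxPlus hQ (proj Q k i)).IsZeroRep)) hne
  | .negSucc n, θ, hne =>
    exact ⟨n + 1, Int.negSucc_eq n, (hP.coxMinus_iterate hQ hL (n + 1) hne).of_iso θ.symm⟩

end QRep

end

end QuivRep

open CategoryTheory in
theorem mainTheorem8_general {V A : Type} [DecidableEq V] [Fintype A] [DecidableEq A]
    {k : Type*} [Field k] (Q : QuivRep.FinQuiver V A) {h : V → ℤ} (hh : Q.IsHeight h)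
    (hsimple : Q.IsSimple) {L : List V} (hL : Q.IsAdmissible L)
    (X Y : QuivRep.QRep Q k) (hX : ¬ X.IsZeroRep) (hY : ¬ Y.IsZeroRep)
    (i j : V) (r s : ℤ)
    (eX : Nonempty (X ≅ QuivRep.QRep.coxPow hL r (QuivRep.QRep.proj Q k i)))
    (eY : Nonempty (Y ≅ QuivRep.QRep.coxPow hL s (QuivRep.QRep.proj Q k j))) :
    (Nonempty (End X ≃ₐ[k] k) ∧
      ∀ φ : X ⟶ Y, ¬ IsIso φ → QuivRep.QRep.IsSumOfIrrComp φ) ∧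
    (((∃ φ : X ⟶ Y, QuivRep.QRep.IsIrreducible φ) ↔
        (r = s ∧ ∃ α, Q.s α = j ∧ Q.t α = i) ∨ (r = s + 1 ∧ ∃ α, Q.s α = i ∧ Q.t α = j)) ∧
      ∀ φ φ' : X ⟶ Y, QuivRep.QRep.IsIrreducible φ → QuivRep.QRep.IsIrreducible φ' →
        ∃ c : k, φ' = c • φ) ∧
    ∃ d : ℕ, (∀ m ≤ d, QuivRep.QRep.radPow m X Y = Set.univ) ∧
      QuivRep.QRep.radPow (d + 1) X Y = {0} := by
  have hlen : 0 < L.length := List.length_pos_of_mem (hL.mem i)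
  have H := hL.sinkOrder hlen hh hsimple
  obtain ⟨m, hr, hX'⟩ := QuivRep.QRep.exists_isPreprojective_of_iso_coxPow hL hlen H hX eX.some
  obtain ⟨m', hs, hY'⟩ := QuivRep.QRep.exists_isPreprojective_of_iso_coxPow hL hlen H hY eY.some
  refine ⟨⟨hX'.isBrick.nonempty_algEquiv, fun φ hφ => hX'.isSumOfIrrComp H hY' hφ⟩,
    ⟨?_, fun φ φ' hφ _ => hX'.exists_eq_smul_of_isIrreducible H hY' hφ φ'⟩,
    hX'.exists_radPow H hY'⟩
  rw [hX'.exists_isIrreducible_iff H hY', hL.follows_iff hlen,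
    show r = s ↔ m = m' by omega, show r = s + 1 ↔ m' = m + 1 by omega]

open CategoryTheory in
theorem mainTheorem8 {V A : Type} [Fintype V] [DecidableEq V] [Fintype A] [DecidableEq A]
    {k : Type*} [Field k] (Q : QuivRep.FinQuiver V A) (hQ : Q.IsDynkin)
    {L : List V} (hL : Q.IsAdmissible L)
    (X Y : QuivRep.QRep Q k) (hX : X.IsIndec) (hY : Y.IsIndec)
    (i j : V) (r s : ℤ)
    (eX : Nonempty (X ≅ QuivRep.QRep.coxPow hL r (QuivRep.QRep.proj Q k i)))
    (eY : Nonempty (Y ≅ QuivRep.QRep.coxPow hL s (QuivRep.QRep.proj Q k j))) :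
    (Nonempty (End X ≃ₐ[k] k) ∧
      ∀ φ : X ⟶ Y, ¬ IsIso φ → QuivRep.QRep.IsSumOfIrrComp φ) ∧
    (((∃ φ : X ⟶ Y, QuivRep.QRep.IsIrreducible φ) ↔
        (r = s ∧ ∃ α, Q.s α = j ∧ Q.t α = i) ∨ (r = s + 1 ∧ ∃ α, Q.s α = i ∧ Q.t α = j)) ∧
      ∀ φ φ' : X ⟶ Y, QuivRep.QRep.IsIrreducible φ → QuivRep.QRep.IsIrreducible φ' →
        ∃ c : k, φ' = c • φ) ∧
    ∃ d : ℕ, (∀ m ≤ d, QuivRep.QRep.radPow m X Y = Set.univ) ∧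
      QuivRep.QRep.radPow (d + 1) X Y = {0} := by
  obtain ⟨h, hh⟩ := hQ.exists_isHeight
  exact mainTheorem8_general Q hh hQ.isSimple hL X Y hX.nonzero hY.nonzero i j r s eX eY
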